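/- Let $\Theta=(0,\tfrac12)$ and $\theta_0\in\Theta$. For $\theta\in\Theta$ let $p_\theta$ be the transition probabilities of the birth–death chain on $\{0,1,2,\dots\}$ with birth probability $\theta$ in every state: $p_\theta(i+1\mid i)=\theta$ for $i\ge 0$, $p_\theta(i-1\mid i)=1-\theta$ for $i\ge 1$, and $p_\theta(0\mid 0)=1-\theta$. Let $q^{(0)}$ be a probability mass function on $\{0,1,2,\dots\}$ with $\sum_i i^2q^{(0)}(i)<\infty$, used as the common initial law. Let $\mathcal F$ be the set of all scaled Beta distributions on $(0,\tfrac12)$, i.e. the laws of $X/2$ with $X\sim\mathrm{Beta}(a',b')$, $a',b'>0$, and let the prior $\pi$ be the scaled Beta distribution with given parameters $a,b>0$. Write $P^{(n)}_\theta$ for the law of $(X_0,\dots,X_n)$ under $p_\theta$ and $q^{(0)}$, $p^{(n)}_\theta$ for its mass function, $r_n(\theta,\theta_0)=\log\big(p^{(n)}_{\theta_0}/p^{(n)}_\theta\big)$, and $\mathcal K$ for the Kullback–Leibler divergence; $\mathrm E$ and $\mathrm{Var}$ refer to $P^{(n)}_{\theta_0}$. For a process with law $P$ let $$\alpha_k=\sup_{t\ge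 0}\ \sup\{|P(A\cap B)-P(A)P(B)| : A\in\sigma(X_0,\dots,X_t),\ B\in\sigma(X_{t+k},X_{t+k+1},\dots)\}.$$ Then there exist $\delta\in(0,1]$, a sequence $\rho_n\in\mathcal F$ $(n\ge1)$ and $\varepsilon_n>0$ with $\varepsilon_n=O(n^{-1/2})$ such that the following conditions (A), (B), (C) hold. **(A) Regularity.** Every $p_\theta$, $\theta\in\Theta$, has an invariant probability mass function $q_\theta$, and there are $m$, positive functions $M^{(1)}_k(x_1,x_0)$, $M^{(2)}_k(x)$ and functions $f^{(1)}_k,f^{(2)}_k$ ($k\le m$) such that, for all $\theta_1,\theta_2\in\Theta$ and all states $x_0,x_1,x$ (with $\log\frac00=0$), $$|\log p_{\theta_1}(x_1|x_0)-\log p_{\theta_2}(x_1|x_0)|\le\sum_k M^{(1)}_k(x_1,x_0)|f^{(1)}_k(\theta_2,\theta_1)|,$$ $$|\log q_{\theta_1}(x)-\log q_{\theta_2}(x)|\le\sum_k M^{(2)}_k(x)|f^{(2)}_k(\theta_2,\theta_1)|;$$ for $t=1,2$ and every $k$ there is a constant $C^{(t)}_k$ with $\int|f^{(t)}_k(\theta,\theta_0)|^{2+\delta}\rho_n(d\theta)<C^{(t)}_k/n$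 for all $n\ge1$; $\sum_{x_0,x_1}M^{(1)}_k(x_1,x_0)^{2+\delta}p_\theta(x_1|x_0)q^{(0)}(x_0)$ is bounded uniformly in $k$ and $\theta\in\Theta$; the $M^{(1)}_k$ are uniformly bounded; $\sum_x M^{(2)}_k(x)^2q^{(0)}(x)<\infty$ for every $k$; and $\mathcal K(\rho_n,\pi)\le C\sqrt n$ for all $n\ge1$ and some constant $C>0$. **(B) Mixing.** The chain with transition probabilities $p_{\theta_0}$ and initial law $q^{(0)}$ is $\alpha$-mixing ($\alpha_k\to0$), and the $\alpha$-mixing coefficients of the stationary chain with transition probabilities $p_{\theta_0}$ satisfy $\sum_{k}\alpha_k^{\delta/(2+\delta)}<\infty$. **(C) PAC-Bayes conditions.** For all $n\ge1$: $r_n(\theta,\theta_0)$ is integrable with $\mathcal K(P^{(n)}_{\theta_0},P^{(n)}_\theta)=\mathrm E[r_n(\theta,\theta_0)]$ for every $\theta\in\Theta$, and $$\int\mathcal K(P^{(n)}_{\theta_0},P^{(n)}_\theta)\,\rho_n(d\theta)\le n\varepsilon_n,\qquad \int\mathrm{Var}\big(r_n(\theta,\theta_0)\big)\rho_n(d\theta)\le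 n\varepsilon_n,\qquad \mathcal K(\rho_n,\pi)\le n\varepsilon_n .$$ Moreover, (A) and (C) (with some $\delta\in(0,1]$, $\rho_n\in\mathcal F$, and $\varepsilon_n>0$, $\varepsilon_n=O(n^{-1/2})$) also hold for the chain with a reflecting barrier, that is, with $p_\theta(1\mid 0)=1$ in place of the transitions from $0$ above. -/

import Mathlib

open MeasureTheory ProbabilityTheory InformationTheory Filter Asymptotics

noncomputable section

/-- `q` is a probability mass function on `ℕ`. -/
def IsPMF (q : ℕ → ℝ) : Prop :=
  (∀ i, 0 ≤ q i) ∧ HasSum q 1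

/-- `q` is an invariant probability mass function of the transition matrix `p`
(`p i j` is the probability of a jump from `i` to `j`). -/
def IsInvariantPMF (p : ℕ → ℕ → ℝ) (q : ℕ → ℝ) : Prop :=
  IsPMF q ∧ ∀ j, HasSum (fun i => q i * p i j) (q j)

/-- Birth-death transition probabilities on `ℕ` with birth probability `θ` in every state:
`i → i + 1` with probability `θ`; with probability `1 - θ` a death `i → i - 1` if `i ≥ 1`,
and no move if `i = 0`. -/
def bdHolding (θ : ℝ) (i j : ℕ) : ℝ :=
  if j = i + 1 then θ
  else if i = j + 1 ∨ (i = 0 ∧ j = 0) then 1 - θ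
  else 0

/-- The variant with a reflecting barrier: as above from a state `i ≥ 1`,
and `0 → 1` with probability one. -/
def bdReflecting (θ : ℝ) (i j : ℕ) : ℝ :=
  if i = 0 then (if j = 1 then 1 else 0)
  else if j = i + 1 then θ
  else if i = j + 1 then 1 - θ
  else 0

/-- The walk probability `q x₀ * ∏ p(x_{i+1} | x_i)`, i.e. the joint probability mass function
of `(X₀, …, X_n)`. -/
def pathMass (q : ℕ → ℝ) (p : ℕ → ℕ → ℝ) (n : ℕ) (x : Fin (n + 1) → ℕ) : ℝ :=
  q (x 0) * ∏ i : Fin n, p (x i.castSucc) (x i.succ)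

/-- The law of `(X₀, …, X_n)`. -/
def pathLaw (q : ℕ → ℝ) (p : ℕ → ℕ → ℝ) (n : ℕ) : Measure (Fin (n + 1) → ℕ) :=
  Measure.count.withDensity (fun x => ENNReal.ofReal (pathMass q p n x))

/-- `μ` is the law on path space of the time-homogeneous Markov chain `(X₀, X₁, …)` with initial
mass function `q` and transition matrix `p`. -/
def IsChainLaw (q : ℕ → ℝ) (p : ℕ → ℕ → ℝ) (μ : Measure (ℕ → ℕ)) : Prop :=
  ∀ n : ℕ, μ.map (fun (x : ℕ → ℕ) (i : Fin (n + 1)) => x i) = pathLaw q p n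

/-- The `σ`-algebra generated by the coordinates with time index in `T`. -/
abbrev coordSigma (T : Set ℕ) : MeasurableSpace (ℕ → ℕ) :=
  ⨆ i ∈ T, MeasurableSpace.comap (fun x : ℕ → ℕ => x i) ⊤

/-- The `α`-mixing coefficient with lag `k` of a process with law `μ`. -/
def alphaMixing (μ : Measure (ℕ → ℕ)) (k : ℕ) : ℝ :=
  sSup {r : ℝ | ∃ (t : ℕ) (A B : Set (ℕ → ℕ)),
    MeasurableSet[coordSigma (Set.Iic t)] A ∧ MeasurableSet[coordSigma (Set.Ici (t + k))] B ∧
    r = |μ.real (A ∩ B) - μ.real A * μ.real B|}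

/-- The log-likelihood ratio `r_n(θ, θ₀) = log (p_{θ₀}^{(n)} / p_θ^{(n)})`, for chains that share
the initial mass function `q0`. -/
def logLikRatio (p : ℝ → ℕ → ℕ → ℝ) (q0 : ℕ → ℝ) (θ0 : ℝ) (n : ℕ) (θ : ℝ)
    (x : Fin (n + 1) → ℕ) : ℝ :=
  Real.log (pathMass q0 (p θ0) n x / pathMass q0 (p θ) n x)

/-- The Beta distribution with parameters `a`, `b`, rescaled to `(0, 1/2)`. -/
def scaledBeta (a b : ℝ) : Measure ℝ :=
  (betaMeasure a b).map (fun x => x / 2)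

/-- The family of all Beta distributions rescaled to `(0, 1/2)`. -/
def scaledBetaFamily : Set (Measure ℝ) :=
  {ρ | ∃ a b : ℝ, 0 < a ∧ 0 < b ∧ ρ = scaledBeta a b}

/-- The generalized Lipschitz condition on the log-ratios of the transition probabilities `p θ` and
of the invariant mass functions `q θ`, `θ ∈ Θ`, together with its moment conditions with exponent
`2 + δ` along the measures `ρ n`. Here `M1 k x₁ x₀` bounds the transition `x₀ → x₁`. In Lean
`Real.log 0 = 0`, so an impossible transition has log-ratio `0`. -/
structure GenLipschitz (Θ : Set ℝ) (p : ℝ → ℕ → ℕ → ℝ) (q : ℝ → ℕ → ℝ) (q0 : ℕ → ℝ)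
    (θ0 δ : ℝ) (ρ : ℕ → Measure ℝ) (m : ℕ) (M1 : Fin m → ℕ → ℕ → ℝ) (M2 : Fin m → ℕ → ℝ)
    (f1 f2 : Fin m → ℝ → ℝ → ℝ) : Prop where
  pos1 : ∀ k x₁ x₀, 0 < M1 k x₁ x₀
  pos2 : ∀ k x, 0 < M2 k x
  lip_transition : ∀ θ₁ ∈ Θ, ∀ θ₂ ∈ Θ, ∀ x₀ x₁ : ℕ,
    |Real.log (p θ₁ x₀ x₁) - Real.log (p θ₂ x₀ x₁)| ≤ ∑ k, M1 k x₁ x₀ * |f1 k θ₂ θ₁|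
  lip_invariant : ∀ θ₁ ∈ Θ, ∀ θ₂ ∈ Θ, ∀ x : ℕ,
    |Real.log (q θ₁ x) - Real.log (q θ₂ x)| ≤ ∑ k, M2 k x * |f2 k θ₂ θ₁|
  small1 : ∀ k, ∃ C : ℝ, ∀ n : ℕ, 1 ≤ n →
    Integrable (fun θ => |f1 k θ θ0| ^ (2 + δ)) (ρ n) ∧
      ∫ θ, |f1 k θ θ0| ^ (2 + δ) ∂(ρ n) < C / n
  small2 : ∀ k, ∃ C : ℝ, ∀ n : ℕ, 1 ≤ n →
    Integrable (fun θ => |f2 k θ θ0| ^ (2 + δ)) (ρ n) ∧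
      ∫ θ, |f2 k θ θ0| ^ (2 + δ) ∂(ρ n) < C / n
  moment : ∃ B : ℝ, ∀ k, ∀ θ ∈ Θ,
    ∑' x₀ : ℕ, ∑' x₁ : ℕ, ENNReal.ofReal (M1 k x₁ x₀ ^ (2 + δ) * p θ x₀ x₁ * q0 x₀)
      < ENNReal.ofReal B

/-- The regularity hypotheses for bounded `M1`: every `p θ`, `θ ∈ Θ`, has an invariant mass
function, the generalized Lipschitz condition holds with bounded `M1`, the `M2` have second moments
under the initial mass function, and `K(ρ_n, π) ≤ C √n`. -/
def RegularityConditions (Θ : Set ℝ) (π : Measure ℝ) (p : ℝ → ℕ → ℕ → ℝ) (q0 : ℕ → ℝ)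
    (θ0 δ : ℝ) (ρ : ℕ → Measure ℝ) : Prop :=
  ∃ (q : ℝ → ℕ → ℝ) (m : ℕ) (M1 : Fin m → ℕ → ℕ → ℝ) (M2 : Fin m → ℕ → ℝ)
    (f1 f2 : Fin m → ℝ → ℝ → ℝ),
    (∀ θ ∈ Θ, IsInvariantPMF (p θ) (q θ)) ∧
    GenLipschitz Θ p q q0 θ0 δ ρ m M1 M2 f1 f2 ∧
    (∃ B : ℝ, ∀ k x y, |M1 k x y| < B) ∧
    (∀ k, Summable (fun i => |M2 k i| ^ 2 * q0 i)) ∧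
    (∃ C : ℝ, 0 < C ∧ ∀ n : ℕ, 1 ≤ n → klDiv (ρ n) π ≤ ENNReal.ofReal (C * √(n : ℝ)))

/-- The mixing hypotheses for the transition matrix `p`: the chain started from `q0` is
`α`-mixing, and the `α`-mixing coefficients of the stationary chain satisfy
`∑ α_k ^ (δ / (2 + δ)) < ∞`. -/
def MixingConditions (p : ℕ → ℕ → ℝ) (q0 : ℕ → ℝ) (δ : ℝ) : Prop :=
  (∀ μ, IsChainLaw q0 p μ → Tendsto (alphaMixing μ) atTop (nhds 0)) ∧
  (∀ q, IsInvariantPMF p q → ∀ μ, IsChainLaw q p μ →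
    Summable (fun k => alphaMixing μ k ^ (δ / (2 + δ))))

/-- The three conditions of the PAC-Bayes concentration bound, at every `n ≥ 1`, with rate `ε`:
(i) `∫ K(P_{θ₀}^{(n)}, P_θ^{(n)}) ρ_n(dθ) = ∫ E[r_n(θ, θ₀)] ρ_n(dθ) ≤ n ε_n`,
(ii) `∫ Var(r_n(θ, θ₀)) ρ_n(dθ) ≤ n ε_n`, and (iii) `K(ρ_n, π) ≤ n ε_n`. -/
structure PACBayesConditions (Θ : Set ℝ) (π : Measure ℝ) (p : ℝ → ℕ → ℕ → ℝ) (q0 : ℕ → ℝ)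
    (θ0 : ℝ) (ρ : ℕ → Measure ℝ) (ε : ℕ → ℝ) : Prop where
  integrable : ∀ n : ℕ, 1 ≤ n → ∀ θ ∈ Θ,
    Integrable (logLikRatio p q0 θ0 n θ) (pathLaw q0 (p θ0) n)
  kl_eq : ∀ n : ℕ, 1 ≤ n → ∀ θ ∈ Θ,
    klDiv (pathLaw q0 (p θ0) n) (pathLaw q0 (p θ) n)
      = ENNReal.ofReal (∫ x, logLikRatio p q0 θ0 n θ x ∂(pathLaw q0 (p θ0) n))
  mean : ∀ n : ℕ, 1 ≤ n →
    ∫⁻ θ, klDiv (pathLaw q0 (p θ0) n) (pathLaw q0 (p θ) n) ∂(ρ n) ≤ ENNReal.ofReal (n * ε n)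
  var : ∀ n : ℕ, 1 ≤ n →
    ∫⁻ θ, evariance (logLikRatio p q0 θ0 n θ) (pathLaw q0 (p θ0) n) ∂(ρ n)
      ≤ ENNReal.ofReal (n * ε n)
  prior : ∀ n : ℕ, 1 ≤ n → klDiv (ρ n) π ≤ ENNReal.ofReal (n * ε n)

end

/-! The measures `ρ n` are scaled Beta laws with parameters `N * (2 * θ0) + a + 3` and `N * (1 - 2 *
θ0) + b + 3`, where `N = n ^ 2`. They concentrate at `θ0` on the scale `1 / n`, finer than the usual
`n ^ (-1/2)`. This makes crude bounds enough: every log-ratio of transition probabilities is at most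
`logDist θ θ0`, so `|r_n| ≤ n * logDist θ θ0` on every path. The mean of `r_n` is then controlled by
`1 + n ^ 2 * logDist ^ 2` and its variance by `4 * n ^ 2 * logDist ^ 2`. Since the second and third
moments of `logDist` under `ρ n` are `O(1 / n ^ 2)` (`exists_lintegral_logDist_pow_le`), both
integrals stay bounded, and no mixing enters (A) or (C).

The price of the fine scale is paid in `K(ρ_n, π)`, and it is only logarithmic. The density of `ρ n`
with respect to the prior is bounded by a constant times `N`: its numerator is largest near `x0 = 2
* θ0`, and the normalising Beta integral is at least `c / N` times the maximal likelihood
(`exists_le_beta`). Hence the divergence is at most `log (K * N)` (`exists_klDiv_scaledBeta_le`),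
which is below a multiple of `√n`.

Condition (B) comes from a coupling. Two holding chains driven by the same steps coincide once the
upper one hits `0`, and `s ^ x` with `θ * s + (1 - θ) / s = lam < 1` is a Lyapunov function for that
time. So `k`-step conditional probabilities of a future event depend on the present state `x` by at
most `min 1 (lam ^ k * s ^ x)`, and `α_k` is at most twice the supremum over `t` of its expectation
at time `t`. Under the stationary law `s ^ x` is integrable and `α_k` decays geometrically. For a
general initial law a drift bound uniform in `t` and dominated convergence give `α_k → 0`. -/

/-! ### Beta integrals and Beta measures. -/

theorem beta_add_one_left {α β : ℝ} (hα : 0 < α) (hβ : 0 < β) :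
    beta (α + 1) β = α / (α + β) * beta α β := by
  have h := (Real.Gamma_pos_of_pos (add_pos hα hβ)).ne'
  unfold beta
  rw [show α + 1 + β = (α + β) + 1 by ring, Real.Gamma_add_one hα.ne',
    Real.Gamma_add_one (add_pos hα hβ).ne']
  field_simp

theorem beta_add_one_right {α β : ℝ} (hα : 0 < α) (hβ : 0 < β) :
    beta α (β + 1) = β / (α + β) * beta α β := by
  have h := (Real.Gamma_pos_of_pos (add_pos hα hβ)).ne'
  unfold beta
  rw [show α + (β + 1) = (α + β) + 1 by ring, Real.Gamma_add_one hβ.ne',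
    Real.Gamma_add_one (add_pos hα hβ).ne']
  field_simp

theorem measurable_betaPDF (α β : ℝ) : Measurable (betaPDF α β) :=
  (measurable_betaPDFReal α β).ennreal_ofReal

/-- Beta laws form an exponential family, so shifting the parameters is a change of density. This
serves three times: for moments, to absorb the singular factor `(x * (1 - x)) ^ (-3)`, and for the
density of `ρ n` with respect to the prior. -/
theorem betaMeasure_add {α β : ℝ} (hα : 0 < α) (hβ : 0 < β) (s t : ℝ) :
    betaMeasure (α + s) (β + t) = (betaMeasure α β).withDensity fun x =>
      ENNReal.ofReal (beta α β / beta (α + s) (β + t) * (x ^ s * (1 - x) ^ t)) := by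
  have hB := beta_pos hα hβ
  unfold betaMeasure
  rw [← withDensity_mul _ (measurable_betaPDF α β) (by fun_prop)]
  congr 1
  funext x
  simp only [Pi.mul_apply, betaPDF_eq]
  split_ifs with hx
  · have h1 : 0 < 1 - x := by linarith [hx.2]
    rw [← ENNReal.ofReal_mul (by have := hx.1; positivity)]
    congr 1
    rw [show α + s - 1 = (α - 1) + s by ring, show β + t - 1 = (β - 1) + t by ring,
      Real.rpow_add hx.1, Real.rpow_add h1]
    field_simp
  · simp

theorem ae_mem_Ioo_betaMeasure (α β : ℝ) : ∀ᵐ x ∂betaMeasure α β, x ∈ Set.Ioo (0 : ℝ) 1 := by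
  unfold betaMeasure
  rw [ae_withDensity_iff (measurable_betaPDF α β)]
  refine ae_of_all _ fun x hx => ?_
  by_contra h
  exact hx (by rw [betaPDF_eq, if_neg (show ¬ (0 < x ∧ x < 1) from h), ENNReal.ofReal_zero])

theorem integral_rpow_mul_rpow_betaMeasure {α β s t : ℝ} (hα : 0 < α) (hβ : 0 < β)
    (hs : 0 < α + s) (ht : 0 < β + t) :
    ∫ x, x ^ s * (1 - x) ^ t ∂betaMeasure α β = beta (α + s) (β + t) / beta α β := by
  have hB := beta_pos hα hβ
  have hB' := beta_pos hs ht
  -- The moment is read off from the total mass one of the tilted Beta law.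
  have h1 := (isProbabilityMeasureBeta hs ht).measure_univ
  rw [betaMeasure_add hα hβ, withDensity_apply _ MeasurableSet.univ, Measure.restrict_univ] at h1
  have h2 : ∫ x, beta α β / beta (α + s) (β + t) * (x ^ s * (1 - x) ^ t) ∂betaMeasure α β = 1 := by
    rw [integral_eq_lintegral_of_nonneg_ae, h1, ENNReal.toReal_one]
    · filter_upwards [ae_mem_Ioo_betaMeasure α β] with x hx
      have h3 : 0 < 1 - x := by linarith [hx.2]
      have := hx.1
      simp only [Pi.zero_apply]
      positivity
    · exact Measurable.aestronglyMeasurable (by fun_prop)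
  rw [integral_const_mul] at h2
  field_simp at h2 ⊢
  linarith

theorem integral_sub_sq_betaMeasure {α β : ℝ} (hα : 0 < α) (hβ : 0 < β) (x0 : ℝ) :
    Integrable (fun x => (x - x0) ^ 2) (betaMeasure α β) ∧
    ∫ x, (x - x0) ^ 2 ∂betaMeasure α β =
      α * β / ((α + β) ^ 2 * (α + β + 1)) + (α / (α + β) - x0) ^ 2 := by
  have hB := beta_pos hα hβ
  have := isProbabilityMeasureBeta hα hβ
  have e1 : ∫ x, x ∂betaMeasure α β = α / (α + β) := by
    have := integral_rpow_mul_rpow_betaMeasure (s := 1) (t := 0) hα hβ (by linarith) (by linarith)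
    simp only [Real.rpow_one, Real.rpow_zero, mul_one, add_zero] at this
    rw [this, beta_add_one_left hα hβ]
    field_simp
  have e2 : ∫ x, x ^ 2 ∂betaMeasure α β = α * (α + 1) / ((α + β) * (α + β + 1)) := by
    have := integral_rpow_mul_rpow_betaMeasure (s := 2) (t := 0) hα hβ (by linarith) (by linarith)
    simp only [Real.rpow_two, Real.rpow_zero, mul_one, add_zero] at this
    rw [this, show α + 2 = (α + 1) + 1 by ring, beta_add_one_left (by linarith) hβ,
      beta_add_one_left hα hβ]
    field_simp
    ring
  have hi : ∀ f : ℝ → ℝ, Continuous f → (∃ C, ∀ x ∈ Set.Ioo (0 : ℝ) 1, |f x| ≤ C) →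
      Integrable f (betaMeasure α β) := by
    rintro f hf ⟨C, hC⟩
    refine Integrable.of_bound hf.aestronglyMeasurable C ?_
    filter_upwards [ae_mem_Ioo_betaMeasure α β] with x hx using hC x hx
  have i1 : Integrable (fun x => x) (betaMeasure α β) :=
    hi _ (by fun_prop) ⟨1, fun x hx => by rw [abs_of_pos hx.1]; exact hx.2.le⟩
  have i2 : Integrable (fun x => x ^ 2) (betaMeasure α β) :=
    hi _ (by fun_prop) ⟨1, fun x hx => by
      rw [abs_of_nonneg (sq_nonneg _)]; nlinarith [hx.1, hx.2]⟩
  have e : (fun x : ℝ => (x - x0) ^ 2) = fun x => (x ^ 2 - 2 * x0 * x) + x0 ^ 2 := by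
    funext x; ring
  have i3 : Integrable (fun x => x ^ 2 - 2 * x0 * x) (betaMeasure α β) := i2.sub (i1.const_mul _)
  refine ⟨by rw [e]; exact i3.add (integrable_const _), ?_⟩
  rw [e, integral_add i3 (integrable_const _), integral_sub i2 (i1.const_mul _),
    integral_const_mul, e1, e2]
  simp only [integral_const, probReal_univ, one_smul]
  field_simp
  ring

/-- Pointwise `φ * log φ + 1 - φ ≤ φ * log S + 1 - φ`, and the right side integrates to `log S`
because `φ` has integral one. -/
theorem klDiv_withDensity_le_log {Ω : Type*} [MeasurableSpace Ω] {ν : Measure Ω}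
    [IsProbabilityMeasure ν] {φ : Ω → ℝ} (hφ : Measurable φ) {S : ℝ} (hS : 1 ≤ S)
    (h0 : ∀ᵐ x ∂ν, 0 ≤ φ x ∧ φ x ≤ S)
    (h1 : IsProbabilityMeasure (ν.withDensity fun x => ENNReal.ofReal (φ x))) :
    klDiv (ν.withDensity fun x => ENNReal.ofReal (φ x)) ν ≤ ENNReal.ofReal (Real.log S) := by
  have hi : Integrable φ ν := by
    refine Integrable.of_bound hφ.aestronglyMeasurable S ?_
    filter_upwards [h0] with x hx
    rw [Real.norm_eq_abs, abs_of_nonneg hx.1]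
    exact hx.2
  have hint : ∫ x, φ x ∂ν = 1 := by
    have := h1.measure_univ
    rw [withDensity_apply _ MeasurableSet.univ, Measure.restrict_univ] at this
    rw [integral_eq_lintegral_of_nonneg_ae (h0.mono fun x hx => hx.1) hφ.aestronglyMeasurable,
      this, ENNReal.toReal_one]
  rw [klDiv_eq_lintegral_klFun_of_ac (withDensity_absolutelyContinuous _ _)]
  have hlog := Real.log_nonneg hS
  calc _ ≤ ∫⁻ x, ENNReal.ofReal (φ x * Real.log S + (1 - φ x)) ∂ν := by
        refine lintegral_mono_ae ?_
        filter_upwards [h0, Measure.rnDeriv_withDensity ν hφ.ennreal_ofReal] with x hx hx'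
        rw [hx', ENNReal.toReal_ofReal hx.1, klFun_apply]
        refine ENNReal.ofReal_le_ofReal ?_
        rcases hx.1.eq_or_lt with h | h
        · rw [← h]; simp
        · have := mul_le_mul_of_nonneg_left (Real.log_le_log h hx.2) hx.1
          linarith
    _ = ENNReal.ofReal (∫ x, φ x * Real.log S + (1 - φ x) ∂ν) := by
        rw [ofReal_integral_eq_lintegral_ofReal]
        · exact (hi.mul_const _).add ((integrable_const _).sub hi)
        · filter_upwards [h0, Measure.rnDeriv_withDensity ν hφ.ennreal_ofReal] with x hx hx'
          have h2 : 0 ≤ klFun (φ x) := klFun_nonneg hx.1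
          rw [klFun_apply] at h2
          simp only [Pi.zero_apply]
          rcases hx.1.eq_or_lt with h | h
          · rw [← h]; simp
          · have := mul_le_mul_of_nonneg_left (Real.log_le_log h hx.2) hx.1
            linarith
    _ = ENNReal.ofReal (Real.log S) := by
        have hi' : Integrable (fun x => 1 - φ x) ν := (integrable_const _).sub hi
        rw [integral_add (hi.mul_const _) hi', integral_mul_const,
          integral_sub (integrable_const _) hi, hint]
        simp

/-! ### The distance `logDist` and its moments under Beta laws. -/

/-- The sum of the absolute differences of the three logarithms `log θ`, `log (1 - 2θ)`, `log (1 - θ)`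
between two parameters. -/
noncomputable def logDist (θ₁ θ₂ : ℝ) : ℝ :=
  |Real.log θ₁ - Real.log θ₂| + |Real.log (1 - 2 * θ₁) - Real.log (1 - 2 * θ₂)| +
    |Real.log (1 - θ₁) - Real.log (1 - θ₂)|

theorem logDist_nonneg (θ₁ θ₂ : ℝ) : 0 ≤ logDist θ₁ θ₂ := by
  unfold logDist; positivity

theorem logDist_comm (θ₁ θ₂ : ℝ) : logDist θ₁ θ₂ = logDist θ₂ θ₁ := by
  simp only [logDist, abs_sub_comm]

theorem measurable_logDist (θ₀ : ℝ) : Measurable fun θ => logDist θ θ₀ := by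
  unfold logDist
  fun_prop

theorem abs_log_sub_log_le {u v : ℝ} (hu : 0 < u) (hu1 : u ≤ 1) (hv : 0 < v) (hv1 : v ≤ 1) :
    |Real.log u - Real.log v| ≤ |u - v| / (u * v) := by
  have key : ∀ {u v : ℝ}, 0 < u → u ≤ 1 → 0 < v → v ≤ 1 →
      Real.log u - Real.log v ≤ |u - v| / (u * v) := by
    intro u v hu hu1 hv hv1
    rw [← Real.log_div hu.ne' hv.ne']
    have h1 := Real.log_le_sub_one_of_pos (div_pos hu hv)
    have h2 : u / v - 1 = (u - v) / v := by field_simp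
    have h3 : (u - v) / v ≤ |u - v| / v := by gcongr; exact le_abs_self _
    have h4 : |u - v| / v ≤ |u - v| / (u * v) := by
      gcongr
      nlinarith
    linarith
  rw [abs_le']
  refine ⟨key hu hu1 hv hv1, ?_⟩
  have := key hv hv1 hu hu1
  rw [abs_sub_comm, mul_comm] at this
  linarith

theorem logDist_half_le {x x0 : ℝ} (hx : x ∈ Set.Ioo (0 : ℝ) 1) (hx0 : x0 ∈ Set.Ioo (0 : ℝ) 1) :
    logDist (x / 2) (x0 / 2) ≤ (1 / x0 + 1 / (1 - x0) + 2) * (|x - x0| / (x * (1 - x))) := by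
  obtain ⟨hx1, hx2⟩ := hx
  obtain ⟨h01, h02⟩ := hx0
  have hx3 : 0 < 1 - x := by linarith
  have h03 : 0 < 1 - x0 := by linarith
  have hle : x * (1 - x) ≤ 1 := by nlinarith
  have hpos : 0 < x * (1 - x) := by positivity
  have e1 : |Real.log (x / 2) - Real.log (x0 / 2)| ≤ 1 / x0 * (|x - x0| / (x * (1 - x))) := by
    rw [Real.log_div hx1.ne' two_ne_zero, Real.log_div h01.ne' two_ne_zero, sub_sub_sub_cancel_right]
    refine (abs_log_sub_log_le hx1 hx2.le h01 h02.le).trans ?_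
    rw [div_mul_div_comm, one_mul]
    exact div_le_div_of_nonneg_left (abs_nonneg _) (by positivity)
      (by nlinarith [mul_pos (mul_pos hx1 h01) hx1])
  have e2 : |Real.log (1 - 2 * (x / 2)) - Real.log (1 - 2 * (x0 / 2))| ≤
      1 / (1 - x0) * (|x - x0| / (x * (1 - x))) := by
    rw [mul_div_cancel₀ _ two_ne_zero, mul_div_cancel₀ _ two_ne_zero]
    refine (abs_log_sub_log_le hx3 (by linarith) h03 (by linarith)).trans ?_
    rw [div_mul_div_comm, one_mul, show 1 - x - (1 - x0) = -(x - x0) by ring, abs_neg]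
    exact div_le_div_of_nonneg_left (abs_nonneg _) (by positivity)
      (by nlinarith [mul_pos (mul_pos hx3 h03) hx3])
  have e3 : |Real.log (1 - x / 2) - Real.log (1 - x0 / 2)| ≤ 2 * (|x - x0| / (x * (1 - x))) := by
    refine (abs_log_sub_log_le (by linarith) (by linarith) (by linarith) (by linarith)).trans ?_
    rw [show 1 - x / 2 - (1 - x0 / 2) = -((x - x0) / 2) by ring, abs_neg, abs_div, abs_two]
    have h1 : |x - x0| / 2 / ((1 - x / 2) * (1 - x0 / 2)) ≤ |x - x0| / 2 / (1 / 4) := by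
      gcongr
      nlinarith
    have h2 : |x - x0| / 1 ≤ |x - x0| / (x * (1 - x)) := by gcongr
    linarith
  unfold logDist
  linarith

/-- Both `|x - x0|` and `x * (1 - x)` are at most one, so one bound covers the powers 2 and 3: the
numerator is relaxed to the square and the denominator to the cube. -/
theorem logDist_half_pow_le {x x0 : ℝ} (hx : x ∈ Set.Ioo (0 : ℝ) 1)
    (hx0 : x0 ∈ Set.Ioo (0 : ℝ) 1) {k : ℕ} (hk2 : 2 ≤ k) (hk3 : k ≤ 3) :
    logDist (x / 2) (x0 / 2) ^ k ≤
      (1 / x0 + 1 / (1 - x0) + 2) ^ 3 * ((x - x0) ^ 2 / (x * (1 - x)) ^ 3) := by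
  have h := logDist_half_le hx hx0
  obtain ⟨hx1, hx2⟩ := hx
  obtain ⟨h01, h02⟩ := hx0
  have hx3 : 0 < 1 - x := by linarith
  have h03 : 0 < 1 - x0 := by linarith
  have hle : x * (1 - x) ≤ 1 := by nlinarith
  have hpos : 0 < x * (1 - x) := by positivity
  have habs : |x - x0| ≤ 1 := by rw [abs_le]; constructor <;> linarith
  have hK : 1 ≤ 1 / x0 + 1 / (1 - x0) + 2 := by
    have : 0 < 1 / x0 := by positivity
    have : 0 < 1 / (1 - x0) := by positivity
    linarith
  refine (pow_le_pow_left₀ (logDist_nonneg _ _) h k).trans ?_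
  rw [mul_pow, div_pow]
  have h1 : (1 / x0 + 1 / (1 - x0) + 2) ^ k ≤ (1 / x0 + 1 / (1 - x0) + 2) ^ 3 :=
    pow_le_pow_right₀ hK hk3
  have h2 : |x - x0| ^ k ≤ (x - x0) ^ 2 := by
    rw [← sq_abs]
    exact pow_le_pow_of_le_one (abs_nonneg _) habs hk2
  have h3 : (x * (1 - x)) ^ 3 ≤ (x * (1 - x)) ^ k := pow_le_pow_of_le_one hpos.le hle hk3
  gcongr

/-- The extra 3 in both parameters supplies a density factor `(x * (1 - x)) ^ 3`, which cancels the
singularity at the endpoints and leaves the second moment about `x0` of an ordinary Beta law. -/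
theorem betaMeasure_add_three_sub_sq_le {α β x0 : ℝ} (hα : 0 < α) (hβ : 0 < β) :
    ∫⁻ x, ENNReal.ofReal ((x - x0) ^ 2 / (x * (1 - x)) ^ 3) ∂betaMeasure (α + 3) (β + 3) =
      ENNReal.ofReal (beta α β / beta (α + 3) (β + 3) *
        (α * β / ((α + β) ^ 2 * (α + β + 1)) + (α / (α + β) - x0) ^ 2)) := by
  have hB := beta_pos hα hβ
  have hB' := beta_pos (show 0 < α + 3 by linarith) (show 0 < β + 3 by linarith)
  obtain ⟨hi, he⟩ := integral_sub_sq_betaMeasure hα hβ x0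
  rw [betaMeasure_add hα hβ, lintegral_withDensity_eq_lintegral_mul _ (by fun_prop) (by fun_prop),
    ← he, ← integral_const_mul, ofReal_integral_eq_lintegral_ofReal (hi.const_mul _)
      (ae_of_all _ fun x => by simp only [Pi.zero_apply]; positivity)]
  refine lintegral_congr_ae ?_
  filter_upwards [ae_mem_Ioo_betaMeasure α β] with x hx
  have h1 := hx.1
  have h2 : 0 < 1 - x := by linarith [hx.2]
  simp only [Pi.mul_apply]
  rw [← ENNReal.ofReal_mul (by positivity)]
  congr 1
  rw [show (3 : ℝ) = ((3 : ℕ) : ℝ) by norm_num, Real.rpow_natCast, Real.rpow_natCast]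
  field_simp

theorem beta_div_beta_add_three_le {α β c : ℝ} (hc : 0 < c) (hα : 0 < α) (hβ : 0 < β)
    (h1 : 1 ≤ α + β) (hcα : c * (α + β) ≤ α) (hcβ : c * (α + β) ≤ β) :
    beta α β / beta (α + 3) (β + 3) ≤ (6 / c) ^ 6 := by
  have hB := beta_pos hα hβ
  have e : beta (α + 3) (β + 3) = (α / (α + β)) * ((α + 1) / (α + β + 1)) *
      ((α + 2) / (α + β + 2)) * (β / (α + β + 3)) * ((β + 1) / (α + β + 4)) *
      ((β + 2) / (α + β + 5)) * beta α β := by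
    rw [show β + 3 = (β + 2) + 1 by ring, beta_add_one_right (by linarith) (by linarith),
      show β + 2 = (β + 1) + 1 by ring, beta_add_one_right (by linarith) (by linarith),
      beta_add_one_right (by linarith) (by linarith),
      show α + 3 = (α + 2) + 1 by ring, beta_add_one_left (by linarith) (by linarith),
      show α + 2 = (α + 1) + 1 by ring, beta_add_one_left (by linarith) (by linarith),
      beta_add_one_left (by linarith) (by linarith)]
    rw [show α + 1 + 1 + 1 + (β + 1 + 1) = α + β + 5 by ring,
      show α + 1 + 1 + 1 + (β + 1) = α + β + 4 by ring,
      show α + 1 + 1 + 1 + β = α + β + 3 by ring,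
      show α + 1 + 1 + β = α + β + 2 by ring,
      show α + 1 + β = α + β + 1 by ring]
    ring
  -- Since `1 ≤ α + β`, each denominator `α + β + k` with `k ≤ 5` is at most `6 * (α + β)`; there
  -- are six such factors.
  have key : ∀ {u k : ℝ}, 0 ≤ k → k ≤ 5 → c * (α + β) ≤ u → c / 6 ≤ u / (α + β + k) := by
    intro u k hk0 hk hu
    rw [div_le_div_iff₀ (by norm_num) (by linarith)]
    nlinarith
  have k0 : c / 6 ≤ α / (α + β) := by
    simpa only [add_zero] using key le_rfl (by norm_num) hcα
  have k1 : c / 6 ≤ (α + 1) / (α + β + 1) := key (by norm_num) (by norm_num) (by linarith)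
  have k2 : c / 6 ≤ (α + 2) / (α + β + 2) := key (by norm_num) (by norm_num) (by linarith)
  have k3 : c / 6 ≤ β / (α + β + 3) := key (by norm_num) (by norm_num) hcβ
  have k4 : c / 6 ≤ (β + 1) / (α + β + 4) := key (by norm_num) (by norm_num) (by linarith)
  have k5 : c / 6 ≤ (β + 2) / (α + β + 5) := key (by norm_num) (by norm_num) (by linarith)
  have hq : (c / 6) ^ 6 * beta α β ≤ beta (α + 3) (β + 3) := by
    rw [e]
    refine mul_le_mul_of_nonneg_right ?_ hB.le
    have hc6 : 0 ≤ c / 6 := by positivity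
    rw [show (c / 6) ^ 6 = c / 6 * (c / 6) * (c / 6) * (c / 6) * (c / 6) * (c / 6) by ring]
    refine mul_le_mul (mul_le_mul (mul_le_mul (mul_le_mul (mul_le_mul k0 k1 hc6 ?_) k2 hc6 ?_)
      k3 hc6 ?_) k4 hc6 ?_) k5 hc6 ?_ <;> positivity
  have hp : 0 < (c / 6) ^ 6 * beta α β := by positivity
  calc beta α β / beta (α + 3) (β + 3) ≤ beta α β / ((c / 6) ^ 6 * beta α β) := by gcongr
    _ = (6 / c) ^ 6 := by field_simp

/-- Weighted arithmetic-geometric mean inequality: the binomial likelihood is maximal at the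
empirical frequency. -/
theorem rpow_mul_rpow_le_of_mem_Ioo {x x0 N : ℝ} (hx : x ∈ Set.Ioo (0 : ℝ) 1)
    (hx0 : x0 ∈ Set.Ioo (0 : ℝ) 1) (hN : 0 ≤ N) :
    x ^ (N * x0) * (1 - x) ^ (N * (1 - x0)) ≤ x0 ^ (N * x0) * (1 - x0) ^ (N * (1 - x0)) := by
  obtain ⟨hx1, hx2⟩ := hx
  obtain ⟨h01, h02⟩ := hx0
  have hx3 : 0 < 1 - x := by linarith
  have h03 : 0 < 1 - x0 := by linarith
  have h := Real.geom_mean_le_arith_mean2_weighted h01.le h03.le (div_pos hx1 h01).le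
    (div_pos hx3 h03).le (by ring)
  rw [mul_div_cancel₀ _ h01.ne', mul_div_cancel₀ _ h03.ne', add_sub_cancel,
    Real.div_rpow hx1.le h01.le, Real.div_rpow hx3.le h03.le, div_mul_div_comm,
    div_le_one (by positivity)] at h
  have h2 := Real.rpow_le_rpow (by positivity) h hN
  rw [Real.mul_rpow (by positivity) (by positivity), Real.mul_rpow (by positivity) (by positivity),
    ← Real.rpow_mul hx1.le, ← Real.rpow_mul hx3.le, ← Real.rpow_mul h01.le,
    ← Real.rpow_mul h03.le] at h2
  simpa only [mul_comm _ N] using h2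

/-- On an interval of length of order `1 / N` to the right of `x0`, the integrand stays above a
fixed fraction of the maximal likelihood. A cruder Laplace bound of order `1 / N` instead of `N ^
(-1/2)` is enough, since only its logarithm matters. -/
theorem exists_le_beta {x0 a b : ℝ} (hx0 : x0 ∈ Set.Ioo (0 : ℝ) 1) (ha : 0 < a) (hb : 0 < b) :
    ∃ c : ℝ, 0 < c ∧ ∀ N : ℝ, 1 ≤ N →
      x0 ^ (N * x0) * (1 - x0) ^ (N * (1 - x0)) * (c / N) ≤
        beta (N * x0 + a + 3) (N * (1 - x0) + b + 3) := by
  obtain ⟨h01, h02⟩ := hx0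
  have h03 : 0 < 1 - x0 := by linarith
  -- The last factor is the interval length `(1 - x0) / (2 * N)`, times `N`, times the loss `1 / 2`
  -- from Bernoulli's inequality.
  refine ⟨x0 ^ (a + 2) * ((1 - x0) / 2) ^ (b + 2) * ((1 - x0) / 4), by positivity, fun N hN => ?_⟩
  have hN0 : 0 < N := by linarith
  set α := N * x0 + a + 3 with hα
  set β := N * (1 - x0) + b + 3 with hβ
  have hα0 : 0 < α := by positivity
  have hβ0 : 0 < β := by positivity
  have hB := beta_pos hα0 hβ0
  set h := (1 - x0) / 2 / N with hh
  have hhpos : 0 < h := by positivity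
  set W := x0 ^ (N * x0) * (1 - x0) ^ (N * (1 - x0)) with hW
  set m := x0 ^ (a + 2) * ((1 - x0) / 2) ^ (b + 2) with hm
  have hlow : ∀ x ∈ Set.Icc x0 (x0 + h), W * (m / 2) / beta α β ≤ betaPDFReal α β x := by
    rintro x ⟨hx1, hx2⟩
    have hN' : h ≤ (1 - x0) / 2 := div_le_self (by linarith) hN
    have hx3 : 0 < 1 - x := by linarith
    rw [betaPDFReal, if_pos ⟨by linarith, by linarith⟩,
      show α - 1 = N * x0 + (a + 2) by rw [hα]; ring,
      show β - 1 = N * (1 - x0) + (b + 2) by rw [hβ]; ring,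
      Real.rpow_add (by linarith), Real.rpow_add hx3]
    have i1 : x0 ^ (N * x0) ≤ x ^ (N * x0) := Real.rpow_le_rpow h01.le hx1 (by positivity)
    have i2 : x0 ^ (a + 2) ≤ x ^ (a + 2) := Real.rpow_le_rpow h01.le hx1 (by positivity)
    have i3 : ((1 - x0) / 2) ^ (b + 2) ≤ (1 - x) ^ (b + 2) :=
      Real.rpow_le_rpow (by positivity) (by linarith) (by positivity)
    -- To the right of `x0` only the powers of `1 - x` decrease. For this one, `1 - x ≥ (1 - x0) *
    -- (1 - 1 / (2 * N))` and Bernoulli's inequality bound the loss by `1 / 2`.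
    have i4 : (1 - x0) ^ (N * (1 - x0)) * (1 / 2) ≤ (1 - x) ^ (N * (1 - x0)) := by
      have hr : 0 ≤ 1 - 1 / (2 * N) := by
        rw [sub_nonneg, div_le_one (by positivity)]; linarith
      have j1 : (1 - x0) * (1 - 1 / (2 * N)) ≤ 1 - x := by
        have : (1 - x0) * (1 - 1 / (2 * N)) = 1 - x0 - h := by rw [hh]; field_simp
        linarith
      refine le_trans ?_ (Real.rpow_le_rpow (by positivity) j1 (by positivity))
      rw [Real.mul_rpow h03.le hr]
      gcongr
      calc (1 / 2 : ℝ) = 1 + N * (-(1 / (2 * N))) := by field_simp; norm_num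
        _ ≤ (1 + -(1 / (2 * N))) ^ N := one_add_mul_self_le_rpow_one_add (by linarith) hN
        _ ≤ (1 - 1 / (2 * N)) ^ (N * (1 - x0)) := by
          rw [← sub_eq_add_neg]
          refine Real.rpow_le_rpow_of_exponent_ge' hr ?_ (by positivity) ?_
          · have : 0 < 1 / (2 * N) := by positivity
            linarith
          · nlinarith
    have hx0' : 0 < x := by linarith
    calc W * (m / 2) / beta α β = 1 / beta α β * (x0 ^ (N * x0) * x0 ^ (a + 2)) *
          ((1 - x0) ^ (N * (1 - x0)) * (1 / 2) * ((1 - x0) / 2) ^ (b + 2)) := by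
          rw [hW, hm]; ring
      _ ≤ _ := by gcongr
  -- The interval has probability at most one, which turns the lower bound on the density into a
  -- lower bound on the normalising constant.
  have hle : ENNReal.ofReal (W * (m / 2) / beta α β * h) ≤ 1 := by
    have := (isProbabilityMeasureBeta hα0 hβ0)
    refine le_trans ?_ (prob_le_one (μ := betaMeasure α β) (s := Set.Icc x0 (x0 + h)))
    rw [betaMeasure, withDensity_apply _ measurableSet_Icc]
    calc _ = ∫⁻ _ in Set.Icc x0 (x0 + h), ENNReal.ofReal (W * (m / 2) / beta α β) := by
          rw [setLIntegral_const, Real.volume_Icc, add_sub_cancel_left,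
            ← ENNReal.ofReal_mul (by positivity)]
      _ ≤ _ := setLIntegral_mono' measurableSet_Icc fun x hx =>
          ENNReal.ofReal_le_ofReal (hlow x hx)
  rw [ENNReal.ofReal_le_one, div_mul_eq_mul_div, div_le_one hB] at hle
  refine le_trans (le_of_eq ?_) hle
  rw [hh]
  field_simp
  norm_num

theorem ae_mem_Ioo_scaledBeta (α β : ℝ) : ∀ᵐ θ ∂scaledBeta α β, θ ∈ Set.Ioo (0 : ℝ) (1 / 2) := by
  unfold scaledBeta
  rw [ae_map_iff (p := fun θ => θ ∈ Set.Ioo (0 : ℝ) (1 / 2)) (by fun_prop) measurableSet_Ioo]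
  filter_upwards [ae_mem_Ioo_betaMeasure α β] with x hx
  exact ⟨by linarith [hx.1], by linarith [hx.2]⟩

theorem exists_lintegral_logDist_pow_le {θ0 a b : ℝ} (hθ0 : θ0 ∈ Set.Ioo (0 : ℝ) (1 / 2))
    (ha : 0 < a) (hb : 0 < b) :
    ∃ K : ℝ, 0 < K ∧ ∀ N : ℝ, 1 ≤ N → ∀ k : ℕ, 2 ≤ k → k ≤ 3 →
      ∫⁻ θ, ENNReal.ofReal (logDist θ θ0 ^ k)
        ∂scaledBeta (N * (2 * θ0) + a + 3) (N * (1 - 2 * θ0) + b + 3) ≤ ENNReal.ofReal (K / N) := by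
  set x0 := 2 * θ0 with hx0def
  have hx0 : x0 ∈ Set.Ioo (0 : ℝ) 1 := ⟨by linarith [hθ0.1], by linarith [hθ0.2]⟩
  have h01 := hx0.1
  have h03 : 0 < 1 - x0 := by linarith [hx0.2]
  set c := min x0 (1 - x0) / (1 + a + b) with hc
  have hc0 : 0 < c := by have := lt_min h01 h03; positivity
  set L := (1 / x0 + 1 / (1 - x0) + 2) ^ 3 with hL
  have hL0 : 0 < L := by positivity
  refine ⟨L * ((6 / c) ^ 6 * (1 + (a + b) ^ 2)), by positivity, fun N hN k hk2 hk3 => ?_⟩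
  have hN0 : 0 < N := by linarith
  set α := N * x0 + a with hα
  set β := N * (1 - x0) + b with hβ
  have hα0 : 0 < α := by positivity
  have hβ0 : 0 < β := by positivity
  have hs : α + β = N + a + b := by rw [hα, hβ]; ring
  have hcs : c * (α + β) ≤ N * min x0 (1 - x0) := by
    rw [hs, hc, div_mul_eq_mul_div, div_le_iff₀ (by positivity), mul_comm N, mul_assoc]
    refine mul_le_mul_of_nonneg_left ?_ (lt_min h01 h03).le
    nlinarith
  have hr : beta α β / beta (α + 3) (β + 3) ≤ (6 / c) ^ 6 := by
    refine beta_div_beta_add_three_le hc0 hα0 hβ0 (by linarith) ?_ ?_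
    · refine hcs.trans ?_
      have := mul_le_mul_of_nonneg_left (min_le_left x0 (1 - x0)) hN0.le
      linarith
    · refine hcs.trans ?_
      have := mul_le_mul_of_nonneg_left (min_le_right x0 (1 - x0)) hN0.le
      linarith
  -- Variance plus squared bias: the variance is at most `1 / N`, and the mean differs from `x0` by
  -- at most `(a + b) / (α + β)`.
  have hvar : α * β / ((α + β) ^ 2 * (α + β + 1)) + (α / (α + β) - x0) ^ 2 ≤
      (1 + (a + b) ^ 2) / N := by
    have v1 : α * β / ((α + β) ^ 2 * (α + β + 1)) ≤ 1 / N := by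
      rw [div_le_div_iff₀ (by positivity) hN0, one_mul]
      have : α * β ≤ (α + β) ^ 2 := by nlinarith
      have : N ≤ α + β + 1 := by linarith
      gcongr
    have v2 : (α / (α + β) - x0) ^ 2 ≤ (a + b) ^ 2 / N := by
      have : α / (α + β) - x0 = (a * (1 - x0) - x0 * b) / (α + β) := by
        rw [eq_div_iff (by positivity), sub_mul, div_mul_cancel₀ _ (by positivity), hs, hα]; ring
      rw [this, div_pow]
      have e1 : (a * (1 - x0) - x0 * b) ^ 2 ≤ (a + b) ^ 2 := by
        refine sq_le_sq' ?_ ?_ <;> nlinarith [hx0.2, mul_pos ha h03, mul_pos h01 hb,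
          mul_pos ha h01, mul_pos hb h03]
      have e2 : N ≤ (α + β) ^ 2 := by nlinarith
      gcongr
    rw [add_div (1 : ℝ)]
    exact add_le_add v1 v2
  have := beta_pos hα0 hβ0
  have := beta_pos (show 0 < α + 3 by linarith) (show 0 < β + 3 by linarith)
  unfold scaledBeta
  rw [lintegral_map (((measurable_logDist θ0).pow_const k).ennreal_ofReal) (by fun_prop)]
  calc _ ≤ ∫⁻ x, ENNReal.ofReal (L * ((x - x0) ^ 2 / (x * (1 - x)) ^ 3))
          ∂betaMeasure (α + 3) (β + 3) := by
        refine lintegral_mono_ae ?_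
        filter_upwards [ae_mem_Ioo_betaMeasure (α + 3) (β + 3)] with x hx
        refine ENNReal.ofReal_le_ofReal ?_
        have h := logDist_half_pow_le hx hx0 hk2 hk3
        rwa [show x0 / 2 = θ0 by rw [hx0def]; ring] at h
    _ = ENNReal.ofReal L * ENNReal.ofReal (beta α β / beta (α + 3) (β + 3) *
        (α * β / ((α + β) ^ 2 * (α + β + 1)) + (α / (α + β) - x0) ^ 2)) := by
        rw [← betaMeasure_add_three_sub_sq_le hα0 hβ0, ← lintegral_const_mul _ (by fun_prop)]
        simp_rw [ENNReal.ofReal_mul hL0.le]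
    _ ≤ _ := by
        rw [← ENNReal.ofReal_mul hL0.le]
        refine ENNReal.ofReal_le_ofReal ?_
        rw [mul_div_assoc L, mul_div_assoc ((6 / c) ^ 6)]
        gcongr

theorem exists_klDiv_scaledBeta_le {θ0 a b : ℝ} (hθ0 : θ0 ∈ Set.Ioo (0 : ℝ) (1 / 2))
    (ha : 0 < a) (hb : 0 < b) :
    ∃ K : ℝ, 1 ≤ K ∧ ∀ N : ℝ, 1 ≤ N →
      klDiv (scaledBeta (N * (2 * θ0) + a + 3) (N * (1 - 2 * θ0) + b + 3)) (scaledBeta a b) ≤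
        ENNReal.ofReal (Real.log (K * N)) := by
  set x0 := 2 * θ0 with hx0def
  have hx0 : x0 ∈ Set.Ioo (0 : ℝ) 1 := ⟨by linarith [hθ0.1], by linarith [hθ0.2]⟩
  have h01 := hx0.1
  have h03 : 0 < 1 - x0 := by linarith [hx0.2]
  obtain ⟨c, hc, hbeta⟩ := exists_le_beta hx0 ha hb
  have hB := beta_pos ha hb
  refine ⟨max 1 (beta a b / c), le_max_left _ _, fun N hN => ?_⟩
  have hN0 : 0 < N := by linarith
  have hα : 0 < N * x0 + a + 3 := by positivity
  have hβ : 0 < N * (1 - x0) + b + 3 := by positivity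
  have hB' := beta_pos hα hβ
  have := isProbabilityMeasureBeta ha hb
  have hp := isProbabilityMeasureBeta hα hβ
  -- Data processing removes the scaling `x ↦ x / 2`.
  refine (klDiv_map_le _ _ (by fun_prop)).trans ?_
  have eα : N * x0 + a + 3 = a + (N * x0 + 3) := by ring
  have eβ : N * (1 - x0) + b + 3 = b + (N * (1 - x0) + 3) := by ring
  have hb' := hbeta N hN
  rw [eα, eβ] at hp hB' hb' ⊢
  rw [betaMeasure_add ha hb] at hp ⊢
  refine klDiv_withDensity_le_log (by fun_prop) ?_ ?_ hp
  · nlinarith [le_max_left 1 (beta a b / c)]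
  filter_upwards [ae_mem_Ioo_betaMeasure a b] with x hx
  have hx1 := hx.1
  have hx3 : 0 < 1 - x := by linarith [hx.2]
  refine ⟨by positivity, ?_⟩
  set W := x0 ^ (N * x0) * (1 - x0) ^ (N * (1 - x0)) with hW
  have hW0 : 0 < W := by positivity
  have h1 : x ^ (N * x0 + 3) * (1 - x) ^ (N * (1 - x0) + 3) ≤ W := by
    rw [Real.rpow_add hx1, Real.rpow_add hx3]
    have j1 := rpow_mul_rpow_le_of_mem_Ioo hx hx0 hN0.le
    have j2 : x ^ (3 : ℝ) ≤ 1 := Real.rpow_le_one hx1.le hx.2.le (by norm_num)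
    have j3 : (1 - x) ^ (3 : ℝ) ≤ 1 := Real.rpow_le_one hx3.le (by linarith) (by norm_num)
    calc x ^ (N * x0) * x ^ (3 : ℝ) * ((1 - x) ^ (N * (1 - x0)) * (1 - x) ^ (3 : ℝ))
        ≤ x ^ (N * x0) * 1 * ((1 - x) ^ (N * (1 - x0)) * 1) := by gcongr
      _ ≤ W := by rw [mul_one, mul_one]; exact j1
  calc _ ≤ beta a b / (W * (c / N)) * W := by gcongr
    _ = beta a b / c * N := by field_simp
    _ ≤ _ := by gcongr; exact le_max_right _ _

/-! ### Path laws and pathwise bounds on the log-likelihood ratio. -/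

/-- `p` is a stochastic matrix on `ℕ`. -/
def IsStochastic (p : ℕ → ℕ → ℝ) : Prop :=
  (∀ i j, 0 ≤ p i j) ∧ ∀ i, HasSum (p i) 1

theorem HasSum.tsum_ofReal_eq_one {f : ℕ → ℝ} (h : HasSum f 1) (h0 : ∀ i, 0 ≤ f i) :
    ∑' i, ENNReal.ofReal (f i) = 1 := by
  rw [← ENNReal.ofReal_tsum_of_nonneg h0 h.summable, h.tsum_eq, ENNReal.ofReal_one]

theorem pathMass_nonneg {q : ℕ → ℝ} {p : ℕ → ℕ → ℝ} (hq : ∀ i, 0 ≤ q i) (hp : ∀ i j, 0 ≤ p i j)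
    (n : ℕ) (x : Fin (n + 1) → ℕ) : 0 ≤ pathMass q p n x :=
  mul_nonneg (hq _) (Finset.prod_nonneg fun _ _ => hp _ _)

theorem pathMass_snoc (q : ℕ → ℝ) (p : ℕ → ℕ → ℝ) (n : ℕ) (w : Fin (n + 1) → ℕ) (y : ℕ) :
    pathMass q p (n + 1) (Fin.snoc (α := fun _ => ℕ) w y) =
      pathMass q p n w * p (w (Fin.last n)) y := by
  unfold pathMass
  rw [Fin.prod_univ_castSucc, ← mul_assoc]
  congr 2
  · refine Finset.prod_congr rfl fun i _ => ?_
    rw [Fin.snoc_castSucc, Fin.succ_castSucc, Fin.snoc_castSucc]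
  · rw [Fin.snoc_castSucc]
  · rw [Fin.succ_last, Fin.snoc_last]

theorem tsum_pathMass {q : ℕ → ℝ} {p : ℕ → ℕ → ℝ} (hq : IsPMF q) (hp : IsStochastic p) (n : ℕ) :
    ∑' x : Fin (n + 1) → ℕ, ENNReal.ofReal (pathMass q p n x) = 1 := by
  induction n with
  | zero =>
    rw [← (Equiv.funUnique (Fin 1) ℕ).symm.tsum_eq]
    simpa [pathMass] using hq.2.tsum_ofReal_eq_one hq.1
  | succ n ih =>
    rw [← (Fin.snocEquiv fun _ => ℕ).tsum_eq, ENNReal.tsum_prod', ENNReal.tsum_comm, ← ih]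
    refine tsum_congr fun w => ?_
    have e (y : ℕ) : Fin.snocEquiv (fun _ => ℕ) (y, w) = Fin.snoc (α := fun _ => ℕ) w y := rfl
    simp only [e, pathMass_snoc,
      ENNReal.ofReal_mul (pathMass_nonneg hq.1 hp.1 n w), ENNReal.tsum_mul_left]
    rw [(hp.2 _).tsum_ofReal_eq_one (hp.1 _), mul_one]

theorem pathLaw_singleton (q : ℕ → ℝ) (p : ℕ → ℕ → ℝ) (n : ℕ) (w : Fin (n + 1) → ℕ) :
    pathLaw q p n {w} = ENNReal.ofReal (pathMass q p n w) := by
  rw [pathLaw, withDensity_apply _ (measurableSet_singleton w), lintegral_singleton,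
    Measure.count_singleton, mul_one]

theorem isProbabilityMeasure_pathLaw {q : ℕ → ℝ} {p : ℕ → ℕ → ℝ} (hq : IsPMF q)
    (hp : IsStochastic p) (n : ℕ) : IsProbabilityMeasure (pathLaw q p n) := by
  refine ⟨?_⟩
  rw [pathLaw, withDensity_apply _ MeasurableSet.univ, Measure.restrict_univ, lintegral_count,
    tsum_pathMass hq hp]

/-- A family of stochastic matrices with common support whose log-entries are Lipschitz with
respect to `logDist`. -/
structure IsLogLipschitzFamily (Θ : Set ℝ) (p : ℝ → ℕ → ℕ → ℝ) : Prop where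
  stochastic : ∀ θ ∈ Θ, IsStochastic (p θ)
  support : ∀ θ₁ ∈ Θ, ∀ θ₂ ∈ Θ, ∀ i j, p θ₁ i j = 0 → p θ₂ i j = 0
  lip : ∀ θ₁ ∈ Θ, ∀ θ₂ ∈ Θ, ∀ i j,
    |Real.log (p θ₁ i j) - Real.log (p θ₂ i j)| ≤ logDist θ₁ θ₂

section

variable {Θ : Set ℝ} {p : ℝ → ℕ → ℕ → ℝ} {q0 : ℕ → ℝ} {θ0 θ : ℝ}

theorem IsLogLipschitzFamily.pathMass_eq_zero (h : IsLogLipschitzFamily Θ p) {θ₁ θ₂ : ℝ}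
    (h1 : θ₁ ∈ Θ) (h2 : θ₂ ∈ Θ) {n : ℕ} {x : Fin (n + 1) → ℕ}
    (hx : pathMass q0 (p θ₁) n x = 0) : pathMass q0 (p θ₂) n x = 0 := by
  unfold pathMass at hx ⊢
  rcases mul_eq_zero.1 hx with hx | hx
  · rw [hx, zero_mul]
  · obtain ⟨i, hi, hi'⟩ := Finset.prod_eq_zero_iff.1 hx
    rw [Finset.prod_eq_zero hi (h.support _ h1 _ h2 _ _ hi'), mul_zero]

/-- The common initial mass cancels, leaving a sum of `n` transition log-ratios. On null paths the
ratio is `0 / 0` and `Real.log 0 = 0`. -/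
theorem IsLogLipschitzFamily.abs_logLikRatio_le (h : IsLogLipschitzFamily Θ p) (h0 : θ0 ∈ Θ)
    (hθ : θ ∈ Θ) (n : ℕ) (x : Fin (n + 1) → ℕ) :
    |logLikRatio p q0 θ0 n θ x| ≤ n * logDist θ θ0 := by
  unfold logLikRatio
  rcases eq_or_ne (pathMass q0 (p θ0) n x) 0 with hx | hx
  · rw [hx, zero_div, Real.log_zero, abs_zero]
    exact mul_nonneg (Nat.cast_nonneg _) (logDist_nonneg _ _)
  have hx' : pathMass q0 (p θ) n x ≠ 0 := fun h' => hx (h.pathMass_eq_zero hθ h0 h')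
  rw [Real.log_div hx hx']
  unfold pathMass at hx hx' ⊢
  rw [mul_ne_zero_iff, Finset.prod_ne_zero_iff] at hx hx'
  rw [Real.log_mul hx.1 (Finset.prod_ne_zero_iff.2 hx.2),
    Real.log_mul hx'.1 (Finset.prod_ne_zero_iff.2 hx'.2), add_sub_add_left_eq_sub,
    Real.log_prod hx.2, Real.log_prod hx'.2, ← Finset.sum_sub_distrib]
  refine (Finset.abs_sum_le_sum_abs _ _).trans ?_
  refine (Finset.sum_le_sum fun i _ => h.lip _ h0 _ hθ _ _).trans ?_
  rw [logDist_comm]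
  simp

theorem IsLogLipschitzFamily.integrable_logLikRatio (h : IsLogLipschitzFamily Θ p)
    (hq : IsPMF q0) (h0 : θ0 ∈ Θ) (hθ : θ ∈ Θ) (n : ℕ) :
    Integrable (logLikRatio p q0 θ0 n θ) (pathLaw q0 (p θ0) n) := by
  have := isProbabilityMeasure_pathLaw hq (h.stochastic _ h0) n
  exact Integrable.of_bound (Measurable.of_discrete).aestronglyMeasurable
    (n * logDist θ θ0) (ae_of_all _ fun x => h.abs_logLikRatio_le h0 hθ n x)

theorem IsLogLipschitzFamily.abs_integral_logLikRatio_le (h : IsLogLipschitzFamily Θ p)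
    (hq : IsPMF q0) (h0 : θ0 ∈ Θ) (hθ : θ ∈ Θ) (n : ℕ) :
    |∫ x, logLikRatio p q0 θ0 n θ x ∂pathLaw q0 (p θ0) n| ≤ n * logDist θ θ0 := by
  have := isProbabilityMeasure_pathLaw hq (h.stochastic _ h0) n
  have := norm_integral_le_of_norm_le_const (μ := pathLaw q0 (p θ0) n)
    (f := logLikRatio p q0 θ0 n θ) (C := n * logDist θ θ0)
    (ae_of_all _ fun x => h.abs_logLikRatio_le (q0 := q0) h0 hθ n x)
  simpa using this

/-- Common support makes the quotient of path masses a genuine density between the two path laws, so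
`logLikRatio` is almost surely the log-likelihood ratio `llr`. -/
theorem IsLogLipschitzFamily.klDiv_pathLaw (h : IsLogLipschitzFamily Θ p)
    (hq : IsPMF q0) (h0 : θ0 ∈ Θ) (hθ : θ ∈ Θ) (n : ℕ) :
    klDiv (pathLaw q0 (p θ0) n) (pathLaw q0 (p θ) n) =
      ENNReal.ofReal (∫ x, logLikRatio p q0 θ0 n θ x ∂pathLaw q0 (p θ0) n) := by
  have := isProbabilityMeasure_pathLaw hq (h.stochastic _ h0) n
  have := isProbabilityMeasure_pathLaw hq (h.stochastic _ hθ) n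
  set ratio : (Fin (n + 1) → ℕ) → ENNReal := fun x =>
    ENNReal.ofReal (pathMass q0 (p θ0) n x / pathMass q0 (p θ) n x) with hratio
  have hm : Measurable ratio := Measurable.of_discrete
  have e : pathLaw q0 (p θ0) n = (pathLaw q0 (p θ) n).withDensity ratio := by
    unfold pathLaw
    rw [← withDensity_mul _ Measurable.of_discrete hm]
    congr 1
    funext x
    have hx := pathMass_nonneg hq.1 (h.stochastic _ hθ).1 n x
    simp only [Pi.mul_apply, hratio]
    rw [← ENNReal.ofReal_mul hx]
    congr 1
    by_cases hx0 : pathMass q0 (p θ) n x = 0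
    · rw [h.pathMass_eq_zero hθ h0 hx0, hx0, zero_mul]
    · rw [mul_div_cancel₀ _ hx0]
  have hac : pathLaw q0 (p θ0) n ≪ pathLaw q0 (p θ) n := by
    rw [e]; exact withDensity_absolutelyContinuous _ _
  have hrn : (pathLaw q0 (p θ0) n).rnDeriv (pathLaw q0 (p θ) n) =ᵐ[pathLaw q0 (p θ) n] ratio := by
    conv_lhs => rw [e]
    exact Measure.rnDeriv_withDensity _ hm
  have hllr : llr (pathLaw q0 (p θ0) n) (pathLaw q0 (p θ) n) =ᵐ[pathLaw q0 (p θ0) n]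
      logLikRatio p q0 θ0 n θ := by
    filter_upwards [hac.ae_le hrn] with x hx
    have h1 := pathMass_nonneg hq.1 (h.stochastic _ hθ).1 n x
    have h2 := pathMass_nonneg hq.1 (h.stochastic _ h0).1 n x
    rw [llr, hx, hratio, logLikRatio, ENNReal.toReal_ofReal (by positivity)]
  rw [klDiv_of_ac_of_integrable hac
    ((h.integrable_logLikRatio hq h0 hθ n).congr hllr.symm), integral_congr_ae hllr]
  simp

theorem IsLogLipschitzFamily.klDiv_pathLaw_le (h : IsLogLipschitzFamily Θ p)
    (hq : IsPMF q0) (h0 : θ0 ∈ Θ) (hθ : θ ∈ Θ) (n : ℕ) :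
    klDiv (pathLaw q0 (p θ0) n) (pathLaw q0 (p θ) n) ≤ ENNReal.ofReal (n * logDist θ θ0) := by
  rw [h.klDiv_pathLaw hq h0 hθ]
  exact ENNReal.ofReal_le_ofReal
    ((le_abs_self _).trans (h.abs_integral_logLikRatio_le hq h0 hθ n))

theorem IsLogLipschitzFamily.evariance_logLikRatio_le (h : IsLogLipschitzFamily Θ p)
    (hq : IsPMF q0) (h0 : θ0 ∈ Θ) (hθ : θ ∈ Θ) (n : ℕ) :
    evariance (logLikRatio p q0 θ0 n θ) (pathLaw q0 (p θ0) n) ≤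
      ENNReal.ofReal (4 * n ^ 2 * logDist θ θ0 ^ 2) := by
  have := isProbabilityMeasure_pathLaw hq (h.stochastic _ h0) n
  rw [evariance_eq_lintegral_ofReal]
  calc _ ≤ ∫⁻ _, ENNReal.ofReal (4 * n ^ 2 * logDist θ θ0 ^ 2) ∂pathLaw q0 (p θ0) n := by
        refine lintegral_mono fun x => ENNReal.ofReal_le_ofReal ?_
        have h1 := abs_le.1 (h.abs_logLikRatio_le (q0 := q0) h0 hθ n x)
        have h2 := abs_le.1 (h.abs_integral_logLikRatio_le hq h0 hθ n)
        have : 4 * (n : ℝ) ^ 2 * logDist θ θ0 ^ 2 = (2 * (n * logDist θ θ0)) ^ 2 := by ring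
        rw [this]
        exact sq_le_sq' (by linarith [h1.1, h2.2]) (by linarith [h1.2, h2.1])
    _ = _ := by simp

end

/-! ### Conditions (A) and (C) for any log-Lipschitz family. -/

theorem exists_regularity_and_PACBayes {p : ℝ → ℕ → ℕ → ℝ} {q : ℝ → ℕ → ℝ} {θ0 a b : ℝ}
    (hp : IsLogLipschitzFamily (Set.Ioo 0 (1 / 2)) p)
    (hinv : ∀ θ ∈ Set.Ioo (0 : ℝ) (1 / 2), IsInvariantPMF (p θ) (q θ))
    (hlip : ∀ θ₁ ∈ Set.Ioo (0 : ℝ) (1 / 2), ∀ θ₂ ∈ Set.Ioo (0 : ℝ) (1 / 2), ∀ x : ℕ,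
      |Real.log (q θ₁ x) - Real.log (q θ₂ x)| ≤ (x + 1) * logDist θ₁ θ₂)
    (hθ0 : θ0 ∈ Set.Ioo (0 : ℝ) (1 / 2)) (ha : 0 < a) (hb : 0 < b)
    {q0 : ℕ → ℝ} (hq0 : IsPMF q0) (hmom : Summable (fun i : ℕ => (i : ℝ) ^ 2 * q0 i)) :
    ∃ (ρ : ℕ → Measure ℝ) (ε : ℕ → ℝ), (∀ n, 1 ≤ n → ρ n ∈ scaledBetaFamily) ∧
      RegularityConditions (Set.Ioo 0 (1 / 2)) (scaledBeta a b) p q0 θ0 1 ρ ∧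
      (∀ n, 1 ≤ n → 0 < ε n) ∧ ε =O[atTop] (fun n : ℕ => 1 / √(n : ℝ)) ∧
      PACBayesConditions (Set.Ioo 0 (1 / 2)) (scaledBeta a b) p q0 θ0 ρ ε := by
  obtain ⟨K, hK, hpow⟩ := exists_lintegral_logDist_pow_le hθ0 ha hb
  obtain ⟨L, hL, hkl⟩ := exists_klDiv_scaledBeta_le hθ0 ha hb
  have h02 : 0 < 2 * θ0 := by linarith [hθ0.1]
  have h03 : 0 < 1 - 2 * θ0 := by linarith [hθ0.2]
  set ρ : ℕ → Measure ℝ := fun n =>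
    scaledBeta ((n : ℝ) ^ 2 * (2 * θ0) + a + 3) ((n : ℝ) ^ 2 * (1 - 2 * θ0) + b + 3) with hρ
  have hprob (n : ℕ) : IsProbabilityMeasure (ρ n) := by
    have := isProbabilityMeasureBeta
      (show 0 < (n : ℝ) ^ 2 * (2 * θ0) + a + 3 by positivity)
      (show 0 < (n : ℝ) ^ 2 * (1 - 2 * θ0) + b + 3 by positivity)
    exact Measure.isProbabilityMeasure_map (by fun_prop)
  have hmem (n : ℕ) : ∀ᵐ θ ∂ρ n, θ ∈ Set.Ioo (0 : ℝ) (1 / 2) := ae_mem_Ioo_scaledBeta _ _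
  have hsq {n : ℕ} (hn : 1 ≤ n) : (1 : ℝ) ≤ (n : ℝ) ^ 2 := one_le_pow₀ (by exact_mod_cast hn)
  have hsqrt {n : ℕ} (hn : 1 ≤ n) : 1 ≤ √(n : ℝ) := Real.one_le_sqrt.2 (by exact_mod_cast hn)
  -- One constant for all three bounds: `1 + K` for the mean, `4 * K` for the variance, `L + 4` for
  -- the divergence from the prior.
  set C := 1 + 4 * K + L + 4 with hC
  have hKL {n : ℕ} (hn : 1 ≤ n) :
      klDiv (ρ n) (scaledBeta a b) ≤ ENNReal.ofReal (C * √(n : ℝ)) := by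
    have hn0 : 0 < √(n : ℝ) := by linarith [hsqrt hn]
    refine (hkl _ (hsq hn)).trans (ENNReal.ofReal_le_ofReal ?_)
    -- Writing `log (L * n ^ 2)` as `log L + 4 * log √n` and using `log u ≤ u - 1` gives a bound
    -- linear in `√n`.
    have e : (n : ℝ) ^ 2 = √(n : ℝ) ^ 4 := by
      rw [show 4 = 2 * 2 from rfl, pow_mul, Real.sq_sqrt (Nat.cast_nonneg _)]
    rw [e, Real.log_mul (by positivity) (by positivity), Real.log_pow]
    have h1 := Real.log_le_sub_one_of_pos (show 0 < L by linarith)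
    have h2 := Real.log_le_sub_one_of_pos hn0
    have h3 := hsqrt hn
    push_cast
    nlinarith
  have hU {n : ℕ} (hn : 1 ≤ n) (k : ℕ) (h2 : 2 ≤ k) (h3 : k ≤ 3) :
      ∫⁻ θ, ENNReal.ofReal (logDist θ θ0 ^ k) ∂ρ n ≤ ENNReal.ofReal (K / (n : ℝ) ^ 2) :=
    hpow _ (hsq hn) k h2 h3
  have hsmall : ∀ n : ℕ, 1 ≤ n →
      Integrable (fun θ => |logDist θ θ0| ^ ((2 : ℝ) + 1)) (ρ n) ∧
        ∫ θ, |logDist θ θ0| ^ ((2 : ℝ) + 1) ∂(ρ n) < (K + 1) / n := by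
    intro n hn
    have hn0 : (1 : ℝ) ≤ n := by exact_mod_cast hn
    have e : (fun θ => |logDist θ θ0| ^ ((2 : ℝ) + 1)) = fun θ => logDist θ θ0 ^ 3 := by
      funext θ
      rw [abs_of_nonneg (logDist_nonneg _ _), show (2 : ℝ) + 1 = ((3 : ℕ) : ℝ) by norm_num,
        Real.rpow_natCast]
    have hm : AEStronglyMeasurable (fun θ => logDist θ θ0 ^ 3) (ρ n) :=
      ((measurable_logDist θ0).pow_const 3).aestronglyMeasurable
    have hnn : 0 ≤ᵐ[ρ n] fun θ => logDist θ θ0 ^ 3 :=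
      ae_of_all _ fun θ => pow_nonneg (logDist_nonneg _ _) 3
    have h := hU hn 3 (by norm_num) le_rfl
    rw [e]
    refine ⟨⟨hm, ?_⟩, ?_⟩
    · rw [hasFiniteIntegral_iff_ofReal hnn]
      exact h.trans_lt ENNReal.ofReal_lt_top
    · rw [integral_eq_lintegral_of_nonneg_ae hnn hm]
      refine (ENNReal.toReal_le_of_le_ofReal (by positivity) h).trans_lt ?_
      rw [div_lt_div_iff₀ (by positivity) (by positivity)]
      nlinarith [mul_le_mul_of_nonneg_left (show (n : ℝ) ≤ (n : ℝ) ^ 2 by nlinarith) hK.le, hsq hn]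
  refine ⟨ρ, fun n => C / √(n : ℝ), fun n _ => ⟨_, _, by positivity, by positivity, rfl⟩, ?_,
    fun n hn => ?_, ?_, ?_⟩
  -- A single term suffices, with both `f` equal to `logDist`. The weight `x + 1` has a second
  -- moment because `q0` does, and with `δ = 1` the required moment of `logDist` is the third.
  · refine ⟨q, 1, fun _ _ _ => 1, fun _ x => x + 1, fun _ => logDist, fun _ => logDist, hinv, ?_,
      ⟨2, fun _ _ _ => by norm_num⟩, fun _ => ?_, ⟨C, by positivity, fun n hn => hKL hn⟩⟩
    · refine ⟨fun _ _ _ => one_pos, fun _ x => by positivity, ?_, ?_, fun _ => ⟨_, hsmall⟩,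
        fun _ => ⟨_, hsmall⟩, ⟨2, fun _ θ hθ => ?_⟩⟩
      · intro θ₁ h1 θ₂ h2 x₀ x₁
        have := hp.lip _ h1 _ h2 x₀ x₁
        rw [logDist_comm] at this
        simpa [abs_of_nonneg (logDist_nonneg _ _)] using this
      · intro θ₁ h1 θ₂ h2 x
        have := hlip _ h1 _ h2 x
        rw [logDist_comm] at this
        simpa [abs_of_nonneg (logDist_nonneg _ _)] using this
      · have hs := hp.stochastic θ hθ
        simp only [Real.one_rpow, one_mul, ENNReal.ofReal_mul (hs.1 _ _), ENNReal.tsum_mul_right]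
        simp only [(hs.2 _).tsum_ofReal_eq_one (hs.1 _), one_mul,
          hq0.2.tsum_ofReal_eq_one hq0.1]
        norm_num
    · refine Summable.of_nonneg_of_le (fun i => mul_nonneg (by positivity) (hq0.1 i)) (fun i => ?_)
        ((hmom.add hq0.2.summable).mul_left 2)
      rw [sq_abs]
      nlinarith [mul_nonneg (sq_nonneg ((i : ℝ) - 1)) (hq0.1 i)]
  · have := hsqrt hn
    positivity
  · refine IsBigO.of_bound C (Eventually.of_forall fun n => ?_)
    rw [div_eq_mul_one_div, norm_mul, Real.norm_of_nonneg (by positivity)]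
  · have hnε {n : ℕ} (hn : 1 ≤ n) : (n : ℝ) * (C / √(n : ℝ)) = C * √(n : ℝ) := by
      have := hsqrt hn
      rw [mul_div_assoc', div_eq_iff (by positivity), mul_assoc,
        Real.mul_self_sqrt (Nat.cast_nonneg _), mul_comm]
    refine ⟨fun n _ θ hθ => hp.integrable_logLikRatio hq0 hθ0 hθ n,
      fun n _ θ hθ => hp.klDiv_pathLaw hq0 hθ0 hθ n, fun n hn => ?_, fun n hn => ?_, fun n hn => ?_⟩
    · rw [hnε hn]
      have hn0 : (0 : ℝ) < n := by exact_mod_cast hn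
      calc _ ≤ ∫⁻ θ, (1 + ENNReal.ofReal ((n : ℝ) ^ 2) * ENNReal.ofReal (logDist θ θ0 ^ 2))
              ∂ρ n := by
            refine lintegral_mono_ae ?_
            filter_upwards [hmem n] with θ hθ
            refine (hp.klDiv_pathLaw_le hq0 hθ0 hθ n).trans ?_
            rw [← ENNReal.ofReal_mul (by positivity), ← ENNReal.ofReal_one,
              ← ENNReal.ofReal_add zero_le_one (by positivity)]
            refine ENNReal.ofReal_le_ofReal ?_
            -- This is `u ≤ 1 + u ^ 2` for `u = n * logDist θ θ0`, which reduces the mean to the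
            -- second moment.
            nlinarith [sq_nonneg (n * logDist θ θ0 - 1)]
        _ ≤ 1 + ENNReal.ofReal ((n : ℝ) ^ 2) * ENNReal.ofReal (K / (n : ℝ) ^ 2) := by
            rw [lintegral_add_left measurable_const, lintegral_const, measure_univ, mul_one,
              lintegral_const_mul' _ _ ENNReal.ofReal_ne_top]
            gcongr
            exact hU hn 2 le_rfl (by norm_num)
        _ ≤ _ := by
            rw [← ENNReal.ofReal_mul (by positivity), ← ENNReal.ofReal_one,
              ← ENNReal.ofReal_add zero_le_one (by positivity), mul_div_cancel₀ _ (by positivity)]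
            refine ENNReal.ofReal_le_ofReal ?_
            nlinarith [hsqrt hn]
    · rw [hnε hn]
      have hn0 : (0 : ℝ) < n := by exact_mod_cast hn
      calc _ ≤ ∫⁻ θ, ENNReal.ofReal (4 * (n : ℝ) ^ 2) * ENNReal.ofReal (logDist θ θ0 ^ 2)
              ∂ρ n := by
            refine lintegral_mono_ae ?_
            filter_upwards [hmem n] with θ hθ
            rw [← ENNReal.ofReal_mul (by positivity)]
            exact hp.evariance_logLikRatio_le hq0 hθ0 hθ n
        _ ≤ ENNReal.ofReal (4 * (n : ℝ) ^ 2) * ENNReal.ofReal (K / (n : ℝ) ^ 2) := by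
            rw [lintegral_const_mul' _ _ ENNReal.ofReal_ne_top]
            gcongr
            exact hU hn 2 le_rfl (by norm_num)
        _ ≤ _ := by
            rw [← ENNReal.ofReal_mul (by positivity), mul_assoc,
              mul_div_cancel₀ _ (by positivity)]
            refine ENNReal.ofReal_le_ofReal ?_
            nlinarith [hsqrt hn]
    · rw [hnε hn]
      exact hKL hn

/-! ### The two birth-death chains and their invariant laws. -/

/-- Truncated subtraction models the barrier: at `i = 0` the downward neighbour `i - 1` is `0`
itself, so holding needs no separate case. -/
theorem hasSum_bdHolding_mul (θ : ℝ) (i : ℕ) (g : ℕ → ℝ) :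
    HasSum (fun j => bdHolding θ i j * g j) (θ * g (i + 1) + (1 - θ) * g (i - 1)) := by
  have e : θ * g (i + 1) + (1 - θ) * g (i - 1) =
      ∑ j ∈ {i + 1, i - 1}, bdHolding θ i j * g j := by
    rw [Finset.sum_pair (by omega)]
    have h2 : bdHolding θ i (i - 1) = 1 - θ := by
      unfold bdHolding
      rw [if_neg (by omega), if_pos (by omega)]
    rw [h2, bdHolding, if_pos rfl]
  rw [e]
  refine hasSum_sum_of_ne_finset_zero fun j hj => ?_
  simp only [Finset.mem_insert, Finset.mem_singleton, not_or] at hj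
  rw [bdHolding, if_neg hj.1, if_neg (by omega), zero_mul]

theorem isStochastic_bdHolding {θ : ℝ} (h0 : 0 ≤ θ) (h1 : θ ≤ 1) : IsStochastic (bdHolding θ) := by
  refine ⟨fun i j => ?_, fun i => ?_⟩
  · unfold bdHolding
    split_ifs <;> linarith
  · simpa using hasSum_bdHolding_mul θ i 1

theorem isStochastic_bdReflecting {θ : ℝ} (h0 : 0 ≤ θ) (h1 : θ ≤ 1) :
    IsStochastic (bdReflecting θ) := by
  refine ⟨fun i j => ?_, fun i => ?_⟩
  · unfold bdReflecting
    split_ifs <;> linarith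
  · rcases Nat.eq_zero_or_pos i with rfl | hi
    · exact hasSum_ite_eq 1 1
    · convert (isStochastic_bdHolding h0 h1).2 i using 1
      funext j
      have : (i = j + 1 ∨ i = 0 ∧ j = 0) ↔ i = j + 1 := by omega
      simp only [bdReflecting, bdHolding, if_neg hi.ne', this]

theorem isLogLipschitzFamily_bdHolding :
    IsLogLipschitzFamily (Set.Ioo 0 (1 / 2)) bdHolding := by
  refine ⟨fun θ hθ => isStochastic_bdHolding hθ.1.le (by linarith [hθ.2]), ?_, ?_⟩
  · rintro θ₁ ⟨h1, h1'⟩ θ₂ _ i j h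
    unfold bdHolding at h ⊢
    split_ifs at h ⊢
    all_goals first | rfl | linarith
  · intro θ₁ _ θ₂ _ i j
    unfold bdHolding logDist
    have := abs_nonneg (Real.log θ₁ - Real.log θ₂)
    have := abs_nonneg (Real.log (1 - 2 * θ₁) - Real.log (1 - 2 * θ₂))
    have := abs_nonneg (Real.log (1 - θ₁) - Real.log (1 - θ₂))
    split_ifs <;> (try simp only [sub_self, abs_zero]) <;> linarith

theorem isLogLipschitzFamily_bdReflecting :
    IsLogLipschitzFamily (Set.Ioo 0 (1 / 2)) bdReflecting := by
  refine ⟨fun θ hθ => isStochastic_bdReflecting hθ.1.le (by linarith [hθ.2]), ?_, ?_⟩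
  · rintro θ₁ ⟨h1, h1'⟩ θ₂ _ i j h
    unfold bdReflecting at h ⊢
    split_ifs at h ⊢
    all_goals first | rfl | linarith
  · intro θ₁ _ θ₂ _ i j
    unfold bdReflecting logDist
    have := abs_nonneg (Real.log θ₁ - Real.log θ₂)
    have := abs_nonneg (Real.log (1 - 2 * θ₁) - Real.log (1 - 2 * θ₂))
    have := abs_nonneg (Real.log (1 - θ₁) - Real.log (1 - θ₂))
    split_ifs <;> (try simp only [sub_self, abs_zero]) <;> linarith

/-- The invariant mass function of `bdHolding θ`. -/
noncomputable def holdingInvariant (θ : ℝ) (i : ℕ) : ℝ :=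
  (1 - 2 * θ) / (1 - θ) * (θ / (1 - θ)) ^ i

/-- The invariant mass function of `bdReflecting θ`. -/
noncomputable def reflectingInvariant (θ : ℝ) : ℕ → ℝ
  | 0 => (1 - 2 * θ) / (2 * (1 - θ))
  | i + 1 => (1 - 2 * θ) / (2 * (1 - θ) ^ 2) * (θ / (1 - θ)) ^ i

theorem hasSum_geometric_odds {θ : ℝ} (hθ : θ ∈ Set.Ioo (0 : ℝ) (1 / 2)) :
    HasSum (fun i : ℕ => (θ / (1 - θ)) ^ i) ((1 - θ) / (1 - 2 * θ)) := by
  obtain ⟨h0, h1⟩ := hθ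
  have h2 : 0 < 1 - θ := by linarith
  have h3 : 1 - 2 * θ ≠ 0 := by linarith
  convert hasSum_geometric_of_lt_one (r := θ / (1 - θ)) (by positivity)
    (by rw [div_lt_one h2]; linarith) using 1
  rw [show 1 - θ / (1 - θ) = (1 - 2 * θ) / (1 - θ) by field_simp; ring, inv_div]

theorem hasSum_mul_bdHolding (θ : ℝ) (q : ℕ → ℝ) (j : ℕ) :
    HasSum (fun i => q i * bdHolding θ i j)
      (q (j + 1) * (1 - θ) + q (j - 1) * (if j = 0 then 1 - θ else θ)) := by
  have e : q (j + 1) * (1 - θ) + q (j - 1) * (if j = 0 then 1 - θ else θ) =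
      ∑ i ∈ {j + 1, j - 1}, q i * bdHolding θ i j := by
    rw [Finset.sum_pair (by omega)]
    have h2 : bdHolding θ (j - 1) j = if j = 0 then 1 - θ else θ := by
      unfold bdHolding
      split_ifs <;> first | rfl | omega
    have h1 : bdHolding θ (j + 1) j = 1 - θ := by
      unfold bdHolding
      rw [if_neg (by omega), if_pos (by omega)]
    rw [h2, h1]
  rw [e]
  refine hasSum_sum_of_ne_finset_zero fun i hi => ?_
  simp only [Finset.mem_insert, Finset.mem_singleton, not_or] at hi
  rw [bdHolding, if_neg (by omega), if_neg (by omega), mul_zero]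

theorem isInvariantPMF_holdingInvariant {θ : ℝ} (hθ : θ ∈ Set.Ioo (0 : ℝ) (1 / 2)) :
    IsInvariantPMF (bdHolding θ) (holdingInvariant θ) := by
  have h0 := hθ.1
  have h2 : 0 < 1 - θ := by linarith [hθ.2]
  have h3 : 0 < 1 - 2 * θ := by linarith [hθ.2]
  refine ⟨⟨fun i => by unfold holdingInvariant; positivity, ?_⟩, fun j => ?_⟩
  · have h := (hasSum_geometric_odds hθ).mul_left ((1 - 2 * θ) / (1 - θ))
    rwa [show (1 - 2 * θ) / (1 - θ) * ((1 - θ) / (1 - 2 * θ)) = 1 by field_simp] at h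
  · convert hasSum_mul_bdHolding θ (holdingInvariant θ) j using 1
    unfold holdingInvariant
    rcases j with _ | j
    · simp
      field_simp
      ring
    · rw [if_neg j.succ_ne_zero, Nat.add_sub_cancel]
      have hr : θ = θ / (1 - θ) * (1 - θ) := by field_simp
      generalize θ / (1 - θ) = r at hr ⊢
      generalize (1 - 2 * θ) / (1 - θ) = c
      -- With `r` the odds, `hr` is the detailed balance relation `θ = r * (1 - θ)`.
      linear_combination (c * r ^ (j + 1) - c * r ^ j) * hr

theorem isInvariantPMF_reflectingInvariant {θ : ℝ} (hθ : θ ∈ Set.Ioo (0 : ℝ) (1 / 2)) :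
    IsInvariantPMF (bdReflecting θ) (reflectingInvariant θ) := by
  have h0 := hθ.1
  have h2 : 0 < 1 - θ := by linarith [hθ.2]
  have h3 : 0 < 1 - 2 * θ := by linarith [hθ.2]
  refine ⟨⟨fun i => by cases i <;> unfold reflectingInvariant <;> positivity, ?_⟩, fun j => ?_⟩
  · rw [← hasSum_nat_add_iff' 1]
    have h := (hasSum_geometric_odds hθ).mul_left ((1 - 2 * θ) / (2 * (1 - θ) ^ 2))
    have e : (1 - 2 * θ) / (2 * (1 - θ) ^ 2) * ((1 - θ) / (1 - 2 * θ)) =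
        1 - ∑ i ∈ Finset.range 1, reflectingInvariant θ i := by
      simp only [Finset.range_one, Finset.sum_singleton, reflectingInvariant]
      field_simp
      ring
    rwa [e] at h
  · have e : reflectingInvariant θ j =
        ∑ i ∈ {j + 1, j - 1}, reflectingInvariant θ i * bdReflecting θ i j := by
      rw [Finset.sum_pair (by omega)]
      rcases j with _ | _ | j
      · simp [reflectingInvariant, bdReflecting]
        field_simp
      · simp [reflectingInvariant, bdReflecting]
        field_simp
        ring
      · simp only [reflectingInvariant, bdReflecting]
        simp
        have hr : θ = θ / (1 - θ) * (1 - θ) := by field_simp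
        generalize θ / (1 - θ) = r at hr ⊢
        generalize (1 - 2 * θ) / (2 * (1 - θ) ^ 2) = c
        linear_combination (c * r ^ (j + 1) - c * r ^ j) * hr
    rw [e]
    refine hasSum_sum_of_ne_finset_zero fun i hi => ?_
    simp only [Finset.mem_insert, Finset.mem_singleton, not_or] at hi
    unfold bdReflecting
    split_ifs <;> first | omega | simp

theorem abs_log_holdingInvariant_sub_le {θ₁ θ₂ : ℝ} (h1 : θ₁ ∈ Set.Ioo (0 : ℝ) (1 / 2))
    (h2 : θ₂ ∈ Set.Ioo (0 : ℝ) (1 / 2)) (x : ℕ) :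
    |Real.log (holdingInvariant θ₁ x) - Real.log (holdingInvariant θ₂ x)| ≤
      (x + 1) * logDist θ₁ θ₂ := by
  have key {θ : ℝ} (hθ : θ ∈ Set.Ioo (0 : ℝ) (1 / 2)) : Real.log (holdingInvariant θ x) =
      Real.log (1 - 2 * θ) - Real.log (1 - θ) + x * (Real.log θ - Real.log (1 - θ)) := by
    have h0 := hθ.1
    have h2 : 0 < 1 - θ := by linarith [hθ.2]
    have h3 : 0 < 1 - 2 * θ := by linarith [hθ.2]
    rw [holdingInvariant, Real.log_mul (by positivity) (by positivity), Real.log_pow,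
      Real.log_div h3.ne' h2.ne', Real.log_div h0.ne' h2.ne']
  rw [key h1, key h2]
  unfold logDist
  generalize hu : Real.log θ₁ - Real.log θ₂ = u
  generalize hv : Real.log (1 - 2 * θ₁) - Real.log (1 - 2 * θ₂) = v
  generalize hw : Real.log (1 - θ₁) - Real.log (1 - θ₂) = w
  have e : Real.log (1 - 2 * θ₁) - Real.log (1 - θ₁) + x * (Real.log θ₁ - Real.log (1 - θ₁)) -
      (Real.log (1 - 2 * θ₂) - Real.log (1 - θ₂) + x * (Real.log θ₂ - Real.log (1 - θ₂))) =
      (v - w) + x * (u - w) := by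
    rw [← hu, ← hv, ← hw]; ring
  rw [e]
  have hx : (0 : ℝ) ≤ x := Nat.cast_nonneg _
  have i1 := abs_add_le (v - w) (x * (u - w))
  rw [abs_mul, abs_of_nonneg hx] at i1
  nlinarith [abs_sub v w, abs_sub u w, abs_nonneg u, abs_nonneg v, abs_nonneg w,
    mul_le_mul_of_nonneg_left (abs_sub u w) hx, mul_nonneg hx (abs_nonneg v)]

theorem abs_log_reflectingInvariant_sub_le {θ₁ θ₂ : ℝ} (h1 : θ₁ ∈ Set.Ioo (0 : ℝ) (1 / 2))
    (h2 : θ₂ ∈ Set.Ioo (0 : ℝ) (1 / 2)) (x : ℕ) :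
    |Real.log (reflectingInvariant θ₁ x) - Real.log (reflectingInvariant θ₂ x)| ≤
      (x + 1) * logDist θ₁ θ₂ := by
  rcases x with _ | x
  · have key {θ : ℝ} (hθ : θ ∈ Set.Ioo (0 : ℝ) (1 / 2)) : Real.log (reflectingInvariant θ 0) =
        Real.log (holdingInvariant θ 0) - Real.log 2 := by
      have h2 : 0 < 1 - θ := by linarith [hθ.2]
      have h3 : 0 < 1 - 2 * θ := by linarith [hθ.2]
      rw [← Real.log_div (by unfold holdingInvariant; positivity) two_ne_zero, holdingInvariant,
        reflectingInvariant]
      congr 1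
      field_simp
    rw [key h1, key h2, sub_sub_sub_cancel_right]
    exact abs_log_holdingInvariant_sub_le h1 h2 0
  · have key {θ : ℝ} (hθ : θ ∈ Set.Ioo (0 : ℝ) (1 / 2)) :
        Real.log (reflectingInvariant θ (x + 1)) =
        -- The reflecting law at `x + 1` is the holding law at `x` divided by `2 * (1 - θ)`. The
        -- extra `log (1 - θ)` costs one more `logDist`, which the index shift provides.
        Real.log (holdingInvariant θ x) - Real.log (1 - θ) - Real.log 2 := by
      have h0 := hθ.1
      have h2 : 0 < 1 - θ := by linarith [hθ.2]
      have h3 : 0 < 1 - 2 * θ := by linarith [hθ.2]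
      have h4 : 0 < holdingInvariant θ x := by unfold holdingInvariant; positivity
      rw [← Real.log_div h4.ne' h2.ne', ← Real.log_div (by positivity) two_ne_zero,
        holdingInvariant, reflectingInvariant]
      congr 1
      field_simp
    have h := abs_log_holdingInvariant_sub_le h1 h2 x
    rw [key h1, key h2, sub_sub_sub_cancel_right, sub_sub_sub_comm]
    have h3 : |Real.log (1 - θ₁) - Real.log (1 - θ₂)| ≤ logDist θ₁ θ₂ := by
      unfold logDist
      have := abs_nonneg (Real.log θ₁ - Real.log θ₂)
      have := abs_nonneg (Real.log (1 - 2 * θ₁) - Real.log (1 - 2 * θ₂))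
      linarith
    have := abs_sub (Real.log (holdingInvariant θ₁ x) - Real.log (holdingInvariant θ₂ x))
      (Real.log (1 - θ₁) - Real.log (1 - θ₂))
    push_cast
    linarith

/-! ### The Markov property on path space. -/

theorem coordSigma_le (T : Set ℕ) : coordSigma T ≤ MeasurableSpace.pi :=
  iSup₂_le fun i _ => (measurable_pi_apply i).comap_le

theorem coordSigma_mono {T T' : Set ℕ} (h : T ⊆ T') : coordSigma T ≤ coordSigma T' :=
  biSup_mono h

theorem measurableSet_coordSigma {T : Set ℕ} {i : ℕ} (hi : i ∈ T) (v : ℕ) :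
    MeasurableSet[coordSigma T] {x : ℕ → ℕ | x i = v} :=
  le_iSup₂ (f := fun i (_ : i ∈ T) => MeasurableSpace.comap (fun x : ℕ → ℕ => x i) ⊤) i hi _
    ⟨{v}, trivial, rfl⟩

theorem exists_eq_preimage_of_measurableSet_Iic {n : ℕ} {E : Set (ℕ → ℕ)}
    (hE : MeasurableSet[coordSigma (Set.Iic n)] E) :
    ∃ S : Set (Fin (n + 1) → ℕ), E = (fun (x : ℕ → ℕ) (i : Fin (n + 1)) => x i) ⁻¹' S := by
  have h : coordSigma (Set.Iic n) ≤
      MeasurableSpace.comap (fun (x : ℕ → ℕ) (i : Fin (n + 1)) => x i) ⊤ := by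
    refine iSup₂_le fun i hi => ?_
    rintro _ ⟨V, -, rfl⟩
    exact ⟨{w | w ⟨i, Nat.lt_succ_of_le hi⟩ ∈ V}, trivial, rfl⟩
  obtain ⟨S, -, hS⟩ := h _ hE
  exact ⟨S, hS.symm⟩

section

variable {q : ℕ → ℝ} {p : ℕ → ℕ → ℝ} {μ : Measure (ℕ → ℕ)}

theorem measurable_path (n : ℕ) :
    Measurable (fun (x : ℕ → ℕ) (i : Fin (n + 1)) => x i) := by fun_prop

theorem IsChainLaw.isProbabilityMeasure (h : IsChainLaw q p μ) (hq : IsPMF q)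
    (hp : IsStochastic p) : IsProbabilityMeasure μ := by
  have := isProbabilityMeasure_pathLaw hq hp 0
  rw [← h 0] at this
  have e := this.measure_univ
  rw [Measure.map_apply (measurable_path 0) MeasurableSet.univ, Set.preimage_univ] at e
  exact ⟨e⟩

/-- Path space is countable at each finite horizon, so it is enough to compare point masses, where
`pathMass_snoc` splits off the last transition. -/
theorem IsChainLaw.map_restrict (h : IsChainLaw q p μ) (hq : IsPMF q) (hp : IsStochastic p)
    (n y : ℕ) :
    (μ.restrict {x | x (n + 1) = y}).map (fun (x : ℕ → ℕ) (i : Fin (n + 1)) => x i) =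
      (pathLaw q p n).withDensity fun w => ENNReal.ofReal (p (w (Fin.last n)) y) := by
  refine Measure.ext_of_singleton fun w => ?_
  have hy : MeasurableSet {x : ℕ → ℕ | x (n + 1) = y} :=
    coordSigma_le Set.univ _ (measurableSet_coordSigma (Set.mem_univ _) y)
  rw [Measure.map_apply (measurable_path n) (measurableSet_singleton w),
    Measure.restrict_apply (measurable_path n (measurableSet_singleton w)),
    withDensity_apply _ (measurableSet_singleton w), lintegral_singleton, pathLaw_singleton,
    mul_comm, ← ENNReal.ofReal_mul (pathMass_nonneg hq.1 hp.1 n w), ← pathMass_snoc,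
    ← pathLaw_singleton, ← h (n + 1),
    Measure.map_apply (measurable_path (n + 1)) (measurableSet_singleton _)]
  congr 1
  ext x
  simp only [Set.mem_inter_iff, Set.mem_preimage, Set.mem_singleton_iff, Set.mem_ofPred_eq,
    funext_iff]
  rw [Fin.forall_fin_succ' (n := n + 1)]
  simp

/-- The Markov property, one step ahead. -/
theorem IsChainLaw.measure_inter_succ (h : IsChainLaw q p μ) (hq : IsPMF q) (hp : IsStochastic p)
    {n : ℕ} {E : Set (ℕ → ℕ)} (hE : MeasurableSet[coordSigma (Set.Iic n)] E) (x y : ℕ) :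
    μ (E ∩ {ω | ω n = x} ∩ {ω | ω (n + 1) = y}) =
      μ (E ∩ {ω | ω n = x}) * ENNReal.ofReal (p x y) := by
  obtain ⟨S, hS⟩ := exists_eq_preimage_of_measurableSet_Iic
    (hE.inter (measurableSet_coordSigma (T := Set.Iic n) (Set.mem_Iic.2 le_rfl) x))
  have hSm : MeasurableSet S := .of_discrete
  have hlast : ∀ w ∈ S, w ∈ Set.range (fun (x : ℕ → ℕ) (i : Fin (n + 1)) => x i) →
      w (Fin.last n) = x := by
    rintro _ hw ⟨ω, rfl⟩
    have : ω ∈ E ∩ {ω | ω n = x} := by rw [hS]; exact hw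
    exact this.2
  have hsurj (w : Fin (n + 1) → ℕ) :
      w ∈ Set.range (fun (x : ℕ → ℕ) (i : Fin (n + 1)) => x i) :=
    ⟨fun i => if hi : i < n + 1 then w ⟨i, hi⟩ else 0, by ext i; simp [i.2]⟩
  have e := congrArg (fun ν => ν S) (h.map_restrict hq hp n y)
  rw [Measure.map_apply (measurable_path n) hSm, Measure.restrict_apply (measurable_path n hSm),
    ← hS, withDensity_apply _ hSm, setLIntegral_congr_fun (g := fun _ => ENNReal.ofReal (p x y)) hSm
      (fun w hw => by simp only [hlast w hw (hsurj w)]), setLIntegral_const, ← h n,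
    Measure.map_apply (measurable_path n) hSm, ← hS] at e
  rw [e, mul_comm]

/-- The trajectories that follow `z` for `l` steps from time `m` on. -/
def cylinderFrom (m l : ℕ) (z : ℕ → ℕ) : Set (ℕ → ℕ) :=
  {x | ∀ i ≤ l, x (m + i) = z i}

theorem cylinderFrom_succ (m l : ℕ) (z : ℕ → ℕ) :
    cylinderFrom m (l + 1) z = cylinderFrom m l z ∩ {x | x (m + l) = z l} ∩
      {x | x (m + l + 1) = z (l + 1)} := by
  ext x
  simp only [cylinderFrom, Set.mem_inter_iff, Set.mem_ofPred_eq]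
  refine ⟨fun h => ⟨⟨fun i hi => h i (by omega), h l (by omega)⟩, h (l + 1) le_rfl⟩,
    fun h i hi => ?_⟩
  rcases Nat.le_succ_iff.1 hi with hi | rfl
  · exact h.1.1 i hi
  · exact h.2

theorem measurableSet_cylinderFrom (m l : ℕ) (z : ℕ → ℕ) :
    MeasurableSet[coordSigma (Set.Icc m (m + l))] (cylinderFrom m l z) := by
  have : cylinderFrom m l z = ⋂ i, ⋂ (_ : i ≤ l), {x | x (m + i) = z i} := by
    ext x; simp [cylinderFrom]
  rw [this]
  refine @MeasurableSet.iInter _ _ (coordSigma (Set.Icc m (m + l))) _ _ fun i =>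
    @MeasurableSet.iInter _ _ (coordSigma (Set.Icc m (m + l))) _ _ fun hi =>
      measurableSet_coordSigma (Set.mem_Icc.2 ⟨by omega, by omega⟩) _

theorem IsChainLaw.measure_inter_cylinderFrom (h : IsChainLaw q p μ) (hq : IsPMF q)
    (hp : IsStochastic p) {m : ℕ} {E : Set (ℕ → ℕ)}
    (hE : MeasurableSet[coordSigma (Set.Iic m)] E) (l : ℕ) (z : ℕ → ℕ) :
    μ (E ∩ cylinderFrom m l z) =
      μ (E ∩ {ω | ω m = z 0}) * ∏ i ∈ Finset.range l, ENNReal.ofReal (p (z i) (z (i + 1))) := by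
  induction l with
  | zero => simp [cylinderFrom]
  | succ l ih =>
    have hm : MeasurableSet[coordSigma (Set.Iic (m + l))] (E ∩ cylinderFrom m l z) :=
      (coordSigma_mono (Set.Iic_subset_Iic.2 (by omega)) _ hE).inter
        (coordSigma_mono Set.Icc_subset_Iic_self _ (measurableSet_cylinderFrom m l z))
    have e : E ∩ cylinderFrom m l z ∩ {ω | ω (m + l) = z l} = E ∩ cylinderFrom m l z :=
      Set.inter_eq_left.2 fun x hx => hx.2 l le_rfl
    rw [cylinderFrom_succ, ← Set.inter_assoc, ← Set.inter_assoc,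
      h.measure_inter_succ hq hp hm, e, ih, Finset.prod_range_succ, mul_assoc]

theorem isPiSystem_cylinderFrom (m : ℕ) :
    IsPiSystem {C | ∃ l z, C = cylinderFrom m l z} := by
  rintro _ ⟨l, z, rfl⟩ _ ⟨l', z', rfl⟩ ⟨x, hx, hx'⟩
  refine ⟨max l l', fun i => x (m + i), ?_⟩
  ext ω
  constructor
  · rintro ⟨h, h'⟩ i hi
    rcases le_max_iff.1 hi with hi | hi
    · exact (h i hi).trans (hx i hi).symm
    · exact (h' i hi).trans (hx' i hi).symm
  · intro h
    exact ⟨fun i hi => (h i (le_max_of_le_left hi)).trans (hx i hi),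
      fun i hi => (h i (le_max_of_le_right hi)).trans (hx' i hi)⟩

theorem coordSigma_Ici_eq_generateFrom (m : ℕ) :
    coordSigma (Set.Ici m) = MeasurableSpace.generateFrom {C | ∃ l z, C = cylinderFrom m l z} := by
  refine le_antisymm (iSup₂_le fun i hi => ?_) (MeasurableSpace.generateFrom_le ?_)
  · rintro _ ⟨V, -, rfl⟩
    obtain ⟨l, rfl⟩ := Nat.exists_eq_add_of_le (Set.mem_Ici.1 hi)
    have e : (fun x : ℕ → ℕ => x (m + l)) ⁻¹' V =
        ⋃ w : Fin (l + 1) → ℕ, ⋃ (_ : w (Fin.last l) ∈ V),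
          cylinderFrom m l (fun i => if hi : i < l + 1 then w ⟨i, hi⟩ else 0) := by
      ext x
      simp only [Set.mem_preimage, Set.mem_iUnion, cylinderFrom, Set.mem_ofPred_eq, exists_prop]
      constructor
      · intro hx
        refine ⟨fun i => x (m + i), hx, fun i hi => ?_⟩
        rw [dif_pos (Nat.lt_succ_of_le hi)]
      · rintro ⟨w, hw, hx⟩
        rw [hx l le_rfl, dif_pos (Nat.lt_succ_self l)]
        exact hw
    rw [e]
    exact @MeasurableSet.iUnion _ _ (_) _ _ fun w => @MeasurableSet.iUnion _ _ (_) _ _ fun _ =>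
      MeasurableSpace.measurableSet_generateFrom ⟨_, _, rfl⟩
  · rintro _ ⟨l, z, rfl⟩
    exact coordSigma_mono Set.Icc_subset_Ici_self _ (measurableSet_cylinderFrom m l z)

/-- The Markov property: given the present, the past and the future are independent. -/
theorem IsChainLaw.measure_inter_future (h : IsChainLaw q p μ) (hq : IsPMF q)
    (hp : IsStochastic p) {m : ℕ} {E B : Set (ℕ → ℕ)}
    (hE : MeasurableSet[coordSigma (Set.Iic m)] E)
    (hB : MeasurableSet[coordSigma (Set.Ici m)] B) (y : ℕ) :
    μ {ω | ω m = y} * μ (B ∩ (E ∩ {ω | ω m = y})) =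
      μ (E ∩ {ω | ω m = y}) * μ (B ∩ {ω | ω m = y}) := by
  have := h.isProbabilityMeasure hq hp
  have hy : MeasurableSet[coordSigma (Set.Iic m)] {ω : ℕ → ℕ | ω m = y} :=
    measurableSet_coordSigma (Set.mem_Iic.2 le_rfl) y
  have hEy := hE.inter hy
  have : IsFiniteMeasure (μ {ω | ω m = y} • μ.restrict (E ∩ {ω | ω m = y})) :=
    Measure.smul_finite _ (measure_ne_top _ _)
  -- As functions of `B` both sides are finite measures. They agree on the cylinders from time `m`,
  -- a generating π-system, because both factor through the same product of transitions. The product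
  -- form avoids dividing by a possibly null event.
  have key := ext_on_measurableSpace_of_generate_finite MeasurableSpace.pi
    (μ := μ {ω | ω m = y} • μ.restrict (E ∩ {ω | ω m = y}))
    (ν := μ (E ∩ {ω | ω m = y}) • μ.restrict {ω | ω m = y})
    {C | ∃ l z, C = cylinderFrom m l z} ?_ (coordSigma_le (Set.Ici m))
    (coordSigma_Ici_eq_generateFrom m) (isPiSystem_cylinderFrom m) ?_ hB
  · simpa only [Measure.smul_apply, smul_eq_mul,
      Measure.restrict_apply (coordSigma_le _ _ hB)] using key
  · rintro _ ⟨l, z, rfl⟩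
    have hC := coordSigma_le _ _ (measurableSet_cylinderFrom m l z)
    simp only [Measure.smul_apply, smul_eq_mul, Measure.restrict_apply hC]
    rw [Set.inter_comm (cylinderFrom m l z),
      Set.inter_comm (cylinderFrom m l z) {ω : ℕ → ℕ | ω m = y},
      h.measure_inter_cylinderFrom hq hp hEy, h.measure_inter_cylinderFrom hq hp hy]
    rcases eq_or_ne (z 0) y with hz | hz
    · rw [hz, Set.inter_self, Set.inter_assoc, Set.inter_self]
      ring
    · have : {ω : ℕ → ℕ | ω m = y} ∩ {ω | ω m = z 0} = ∅ := by
        ext ω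
        simp only [Set.mem_inter_iff, Set.mem_ofPred_eq, Set.mem_empty_iff_false, iff_false]
        rintro ⟨h1, h2⟩
        exact hz (h2.symm.trans h1)
      rw [Set.inter_assoc, this]
      simp
  · simp [mul_comm]

/-- The law of the state at time `n` on the event `A`. -/
noncomputable def stateLaw (μ : Measure (ℕ → ℕ)) (A : Set (ℕ → ℕ)) (n : ℕ) : Measure ℕ :=
  (μ.restrict A).map fun x => x n

theorem stateLaw_singleton (A : Set (ℕ → ℕ)) (n y : ℕ) :
    stateLaw μ A n {y} = μ (A ∩ {ω | ω n = y}) := by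
  rw [stateLaw, Measure.map_apply (measurable_pi_apply n) (measurableSet_singleton y),
    Measure.restrict_apply (measurable_pi_apply n (measurableSet_singleton y)), Set.inter_comm]
  rfl

theorem stateLaw_univ (A : Set (ℕ → ℕ)) (n : ℕ) : stateLaw μ A n Set.univ = μ A := by
  rw [stateLaw, Measure.map_apply (measurable_pi_apply n) MeasurableSet.univ]
  simp

theorem IsChainLaw.exists_measure_inter_eq_lintegral (h : IsChainLaw q p μ) (hq : IsPMF q)
    (hp : IsStochastic p) {m : ℕ} {B : Set (ℕ → ℕ)}
    (hB : MeasurableSet[coordSigma (Set.Ici m)] B) :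
    ∃ g : ℕ → ℝ, (∀ y, 0 ≤ g y ∧ g y ≤ 1) ∧ ∀ A, MeasurableSet[coordSigma (Set.Iic m)] A →
      μ (A ∩ B) = ∫⁻ y, ENNReal.ofReal (g y) ∂stateLaw μ A m := by
  have := h.isProbabilityMeasure hq hp
  have hle (y : ℕ) : μ (B ∩ {ω | ω m = y}) / μ {ω | ω m = y} ≤ 1 :=
    ENNReal.div_le_of_le_mul (by rw [one_mul]; exact measure_mono Set.inter_subset_right)
  -- The function is the conditional probability of `B` given the state at time `m`; at a null state
  -- the quotient `0 / 0` is `0`, which does no harm.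
  refine ⟨fun y => (μ (B ∩ {ω | ω m = y}) / μ {ω | ω m = y}).toReal,
    fun y => ⟨ENNReal.toReal_nonneg, ?_⟩, fun A hA => ?_⟩
  · simpa using ENNReal.toReal_mono ENNReal.one_ne_top (hle y)
  · rw [← stateLaw_univ (A ∩ B) m, ← lintegral_one, lintegral_countable', lintegral_countable']
    refine tsum_congr fun y => ?_
    rw [ENNReal.ofReal_toReal ((hle y).trans_lt ENNReal.one_lt_top).ne, one_mul,
      stateLaw_singleton, stateLaw_singleton]
    have key := h.measure_inter_future hq hp hA hB y
    have e : A ∩ B ∩ {ω : ℕ → ℕ | ω m = y} = B ∩ (A ∩ {ω | ω m = y}) := by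
      rw [Set.inter_comm A, Set.inter_assoc]
    rw [e]
    rcases eq_or_ne (μ {ω | ω m = y}) 0 with h0 | h0
    · have h1 : μ (A ∩ {ω | ω m = y}) = 0 := measure_mono_null Set.inter_subset_right h0
      rw [measure_mono_null Set.inter_subset_right h1, h1, mul_zero]
    · rw [mul_comm, ← mul_div_assoc, ← key, mul_comm,
        ENNReal.mul_div_cancel_right h0 (measure_ne_top _ _)]

theorem IsChainLaw.stateLaw_succ_singleton (h : IsChainLaw q p μ) (hq : IsPMF q)
    (hp : IsStochastic p) {n : ℕ} {A : Set (ℕ → ℕ)}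
    (hA : MeasurableSet[coordSigma (Set.Iic n)] A) (y : ℕ) :
    stateLaw μ A (n + 1) {y} = ∑' x, stateLaw μ A n {x} * ENNReal.ofReal (p x y) := by
  have hy : MeasurableSet[coordSigma Set.univ] {ω : ℕ → ℕ | ω (n + 1) = y} :=
    measurableSet_coordSigma (Set.mem_univ _) y
  rw [stateLaw_singleton, ← stateLaw_univ (A ∩ {ω | ω (n + 1) = y}) n, ← lintegral_one,
    lintegral_countable']
  refine tsum_congr fun x => ?_
  rw [one_mul, stateLaw_singleton, stateLaw_singleton, ← h.measure_inter_succ hq hp hA,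
    Set.inter_right_comm]

theorem IsChainLaw.lintegral_stateLaw_succ (h : IsChainLaw q p μ) (hq : IsPMF q)
    (hp : IsStochastic p) {n : ℕ} {A : Set (ℕ → ℕ)}
    (hA : MeasurableSet[coordSigma (Set.Iic n)] A) (g : ℕ → ENNReal) :
    ∫⁻ y, g y ∂stateLaw μ A (n + 1) =
      ∫⁻ x, ∑' y, ENNReal.ofReal (p x y) * g y ∂stateLaw μ A n := by
  rw [lintegral_countable', lintegral_countable']
  simp only [h.stateLaw_succ_singleton hq hp hA, ← ENNReal.tsum_mul_left, ← ENNReal.tsum_mul_right]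
  rw [ENNReal.tsum_comm]
  refine tsum_congr fun x => tsum_congr fun y => ?_
  ring

theorem IsChainLaw.stateLaw_zero_singleton (h : IsChainLaw q p μ) (y : ℕ) :
    stateLaw μ Set.univ 0 {y} = ENNReal.ofReal (q y) := by
  have e : {ω : ℕ → ℕ | ω 0 = y} = (fun (x : ℕ → ℕ) (i : Fin (0 + 1)) => x i) ⁻¹' {fun _ => y} := by
    ext ω
    simp [funext_iff]
  rw [stateLaw_singleton, Set.univ_inter, e,
    ← Measure.map_apply (measurable_path 0) (measurableSet_singleton _), h 0, pathLaw_singleton]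
  simp [pathMass]

theorem IsChainLaw.stateLaw_singleton_of_invariant (h : IsChainLaw q p μ)
    (hq : IsInvariantPMF p q) (hp : IsStochastic p) (n y : ℕ) :
    stateLaw μ Set.univ n {y} = ENNReal.ofReal (q y) := by
  induction n generalizing y with
  | zero => exact h.stateLaw_zero_singleton y
  | succ n ih =>
    rw [h.stateLaw_succ_singleton hq.1 hp (@MeasurableSet.univ _ (coordSigma (Set.Iic n))),
      ← (hq.2 y).tsum_eq,
      ENNReal.ofReal_tsum_of_nonneg (fun i => mul_nonneg (hq.1.1 i) (hp.1 i y)) (hq.2 y).summable]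
    exact tsum_congr fun x => by rw [ih, ENNReal.ofReal_mul (hq.1.1 x)]

end

/-! ### Coupling, drift and mixing of the holding chain. -/

/-- The transition operator of `bdHolding θ`. -/
noncomputable def bdOp (θ : ℝ) (g : ℕ → ℝ) (x : ℕ) : ℝ :=
  θ * g (x + 1) + (1 - θ) * g (x - 1)

section

variable {θ s lam : ℝ}

theorem bdOp_iterate_mem_Icc (h0 : 0 ≤ θ) (h1 : θ ≤ 1) {g : ℕ → ℝ}
    (hg : ∀ y, 0 ≤ g y ∧ g y ≤ 1) (k x : ℕ) : 0 ≤ (bdOp θ)^[k] g x ∧ (bdOp θ)^[k] g x ≤ 1 := by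
  induction k generalizing x with
  | zero => exact hg x
  | succ k ih =>
    rw [Function.iterate_succ_apply', bdOp]
    obtain ⟨u0, u1⟩ := ih (x + 1)
    obtain ⟨v0, v1⟩ := ih (x - 1)
    constructor <;> nlinarith

/-- Two chains driven by the same steps meet when the upper one reaches `0`. -/
theorem abs_bdOp_iterate_sub_le (h0 : 0 < θ) (h1 : θ < 1) (hs : 1 ≤ s)
    (hlam : θ * s + (1 - θ) / s = lam) {g : ℕ → ℝ} (hg : ∀ y, 0 ≤ g y ∧ g y ≤ 1) (k x y : ℕ) :
    |(bdOp θ)^[k] g x - (bdOp θ)^[k] g y| ≤ lam ^ k * s ^ max x y := by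
  have hs0 : 0 < s := by linarith
  have h1' : 0 < 1 - θ := by linarith
  have hl : 0 < lam := by rw [← hlam]; positivity
  induction k generalizing x y with
  | zero =>
    have := hg x
    have := hg y
    have h3 : 1 ≤ s ^ max x y := one_le_pow₀ hs
    simp only [Function.iterate_zero, id_eq, pow_zero, one_mul]
    rw [abs_le]
    constructor <;> linarith
  | succ k ih =>
    rw [Function.iterate_succ_apply', bdOp, bdOp]
    -- When the maximum is `0` the chains have met. Otherwise a common step moves the maximum up or
    -- down by exactly one, even if the lower chain is held at `0`, and `s ^ max` contracts by `lam`
    -- on average.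
    rcases Nat.eq_zero_or_pos (max x y) with hm | hm
    · obtain ⟨rfl, rfl⟩ : x = 0 ∧ y = 0 := by omega
      rw [sub_self, abs_zero]
      positivity
    · have i1 := ih (x + 1) (y + 1)
      have i2 := ih (x - 1) (y - 1)
      obtain ⟨m, hm'⟩ := Nat.exists_eq_succ_of_ne_zero hm.ne'
      rw [show max (x + 1) (y + 1) = m + 2 by omega] at i1
      rw [show max (x - 1) (y - 1) = m by omega] at i2
      rw [hm']
      set u := (bdOp θ)^[k] g
      calc |θ * u (x + 1) + (1 - θ) * u (x - 1) - (θ * u (y + 1) + (1 - θ) * u (y - 1))|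
          = |θ * (u (x + 1) - u (y + 1)) + (1 - θ) * (u (x - 1) - u (y - 1))| := by
            congr 1; ring
        _ ≤ θ * |u (x + 1) - u (y + 1)| + (1 - θ) * |u (x - 1) - u (y - 1)| := by
            refine (abs_add_le _ _).trans (le_of_eq ?_)
            rw [abs_mul, abs_mul, abs_of_pos h0, abs_of_pos h1']
        _ ≤ θ * (lam ^ k * s ^ (m + 2)) + (1 - θ) * (lam ^ k * s ^ m) := by gcongr
        _ = lam ^ (k + 1) * s ^ (m + 1) := by
            rw [pow_succ lam, ← hlam]
            field_simp
            ring

/-- The geometric weight that bounds the distance to equilibrium after `k` steps. -/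
noncomputable def mixingWeight (s lam : ℝ) (k x : ℕ) : ℝ :=
  min 1 (lam ^ k * s ^ x)

theorem mixingWeight_mem_Icc (hs : 0 ≤ s) (hl : 0 ≤ lam) (k x : ℕ) :
    0 ≤ mixingWeight s lam k x ∧ mixingWeight s lam k x ≤ 1 :=
  ⟨le_min zero_le_one (by positivity), min_le_left _ _⟩

/-- A Foster-Lyapunov estimate, uniform in the number `t` of steps. -/
theorem bdOp_iterate_mixingWeight_le (h0 : 0 < θ) (h1 : θ < 1) (hs : 1 ≤ s)
    (hlam : θ * s + (1 - θ) / s = lam) (hl1 : lam < 1) (k t x : ℕ) :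
    (bdOp θ)^[t] (mixingWeight s lam k) x ≤ lam ^ k * (s ^ x + 1 / (1 - lam)) := by
  have hs0 : 0 < s := by linarith
  have h1' : 0 < 1 - θ := by linarith
  have hl : 0 < lam := by rw [← hlam]; positivity
  have hl1' : 0 < 1 - lam := by linarith
  -- The induction needs the explicit partial geometric sum; the bound free of `t` follows from it.
  have key (t x : ℕ) : (bdOp θ)^[t] (mixingWeight s lam k) x ≤
      lam ^ k * (lam ^ t * s ^ x + (1 - lam ^ t) / (1 - lam)) := by
    induction t generalizing x with
    | zero =>
      simp only [Function.iterate_zero, id_eq, pow_zero, one_mul, sub_self, zero_div, add_zero]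
      exact min_le_right _ _
    | succ t ih =>
      -- The drift is exactly `lam * s ^ x` away from `0`; the additive `1` is needed only at the
      -- barrier.
      have hV : θ * s ^ (x + 1) + (1 - θ) * s ^ (x - 1) ≤ lam * s ^ x + 1 := by
        rcases x with _ | x
        · have : 0 ≤ (1 - θ) / s := by positivity
          simp only [zero_add, pow_one, Nat.zero_sub, pow_zero, mul_one]
          linarith
        · have : θ * s ^ (x + 1 + 1) + (1 - θ) * s ^ (x + 1 - 1) = lam * s ^ (x + 1) := by
            rw [← hlam, Nat.add_sub_cancel]
            field_simp
            ring
          linarith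
      rw [Function.iterate_succ_apply', bdOp]
      calc _ ≤ θ * (lam ^ k * (lam ^ t * s ^ (x + 1) + (1 - lam ^ t) / (1 - lam))) +
            (1 - θ) * (lam ^ k * (lam ^ t * s ^ (x - 1) + (1 - lam ^ t) / (1 - lam))) := by
            gcongr
            · exact ih _
            · exact ih _
        _ = lam ^ k * (lam ^ t * (θ * s ^ (x + 1) + (1 - θ) * s ^ (x - 1)) +
            (1 - lam ^ t) / (1 - lam)) := by ring
        _ ≤ lam ^ k * (lam ^ t * (lam * s ^ x + 1) + (1 - lam ^ t) / (1 - lam)) := by gcongr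
        _ = _ := by
            congr 1
            field_simp
            ring
  refine (key t x).trans ?_
  have e1 : lam ^ t ≤ 1 := pow_le_one₀ hl.le hl1.le
  have e2 : 0 < lam ^ t := by positivity
  gcongr
  · exact mul_le_of_le_one_left (by positivity) e1
  · linarith

theorem IsChainLaw.lintegral_stateLaw_bdOp {q : ℕ → ℝ} {μ : Measure (ℕ → ℕ)}
    (h : IsChainLaw q (bdHolding θ) μ) (hq : IsPMF q) (h0 : 0 ≤ θ) (h1 : θ ≤ 1) {n : ℕ}
    {A : Set (ℕ → ℕ)} (hA : MeasurableSet[coordSigma (Set.Iic n)] A) (k : ℕ) {g : ℕ → ℝ}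
    (hg : ∀ y, 0 ≤ g y ∧ g y ≤ 1) :
    ∫⁻ y, ENNReal.ofReal (g y) ∂stateLaw μ A (n + k) =
      ∫⁻ x, ENNReal.ofReal ((bdOp θ)^[k] g x) ∂stateLaw μ A n := by
  have hp := isStochastic_bdHolding h0 h1
  induction k generalizing g with
  | zero => rfl
  | succ k ih =>
    have hg' : ∀ y, 0 ≤ bdOp θ g y ∧ bdOp θ g y ≤ 1 := bdOp_iterate_mem_Icc h0 h1 hg 1
    rw [Function.iterate_succ_apply, ← ih hg', ← Nat.add_assoc,
      h.lintegral_stateLaw_succ hq hp (coordSigma_mono (Set.Iic_subset_Iic.2 (by omega)) _ hA)]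
    refine lintegral_congr fun x => ?_
    have hsum := hasSum_bdHolding_mul θ x g
    rw [bdOp, ← hsum.tsum_eq, ENNReal.ofReal_tsum_of_nonneg
      (fun y => mul_nonneg (hp.1 x y) (hg y).1) hsum.summable]
    exact tsum_congr fun y => (ENNReal.ofReal_mul (hp.1 x y)).symm

/-- With `f x` the probability of `B` given state `x` at time `t`, the covariance of `A` and `B` is
unchanged when the constant `f 0` is subtracted from `f`. The coupling bounds `|f x - f 0|` by the
mixing weight, once for `A` and once for the whole space. -/
theorem IsChainLaw.abs_measure_inter_sub_le {q : ℕ → ℝ} {μ : Measure (ℕ → ℕ)}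
    (h : IsChainLaw q (bdHolding θ) μ) (hq : IsPMF q) (h0 : 0 < θ) (h1 : θ < 1) (hs : 1 ≤ s)
    (hlam : θ * s + (1 - θ) / s = lam) {t k : ℕ} {A B : Set (ℕ → ℕ)}
    (hA : MeasurableSet[coordSigma (Set.Iic t)] A)
    (hB : MeasurableSet[coordSigma (Set.Ici (t + k))] B) :
    |μ.real (A ∩ B) - μ.real A * μ.real B| ≤
      2 * ∫ x, mixingWeight s lam k x ∂stateLaw μ Set.univ t := by
  have hp := isStochastic_bdHolding h0.le h1.le
  have := h.isProbabilityMeasure hq hp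
  have hs0 : 0 < s := by linarith
  have h1' : 0 < 1 - θ := by linarith
  have hl : 0 < lam := by rw [← hlam]; positivity
  obtain ⟨g, hg, hgB⟩ := h.exists_measure_inter_eq_lintegral hq hp hB
  set f := (bdOp θ)^[k] g with hf
  have hf01 : ∀ x, 0 ≤ f x ∧ f x ≤ 1 := bdOp_iterate_mem_Icc h0.le h1.le hg k
  have hfw (x : ℕ) : |f x - f 0| ≤ mixingWeight s lam k x := by
    refine le_min ?_ ?_
    · have := hf01 x
      have := hf01 0
      rw [abs_le]
      constructor <;> linarith
    · simpa using abs_bdOp_iterate_sub_le h0 h1 hs hlam hg k x 0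
  have hfin (E : Set (ℕ → ℕ)) : IsFiniteMeasure (stateLaw μ E t) :=
    ⟨by rw [stateLaw_univ]; exact measure_lt_top _ _⟩
  have hint (E : Set (ℕ → ℕ)) {u : ℕ → ℝ} (hu : ∀ x, 0 ≤ u x ∧ u x ≤ 1) :
      Integrable u (stateLaw μ E t) :=
    Integrable.of_bound (Measurable.of_discrete).aestronglyMeasurable 1
      (ae_of_all _ fun x => by rw [Real.norm_of_nonneg (hu x).1]; exact (hu x).2)
  have hreal {E : Set (ℕ → ℕ)} (hE : MeasurableSet[coordSigma (Set.Iic t)] E) :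
      μ.real (E ∩ B) = ∫ x, f x ∂stateLaw μ E t := by
    rw [measureReal_def, hgB E (coordSigma_mono (Set.Iic_subset_Iic.2 (by omega)) _ hE),
      h.lintegral_stateLaw_bdOp hq h0.le h1.le hE k hg,
      integral_eq_lintegral_of_nonneg_ae (ae_of_all _ fun x => (hf01 x).1)
        (Measurable.of_discrete).aestronglyMeasurable]
  have hcenter (E : Set (ℕ → ℕ)) :
      ∫ x, f x ∂stateLaw μ E t = ∫ x, (f x - f 0) ∂stateLaw μ E t + μ.real E * f 0 := by
    rw [integral_sub (hint E hf01) (integrable_const _), integral_const, measureReal_def,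
      stateLaw_univ, smul_eq_mul, measureReal_def, sub_add_cancel]
  have hw := mixingWeight_mem_Icc hs0.le hl.le k
  have hdev (E : Set (ℕ → ℕ)) : |∫ x, (f x - f 0) ∂stateLaw μ E t| ≤
      ∫ x, mixingWeight s lam k x ∂stateLaw μ Set.univ t := by
    refine (norm_integral_le_of_norm_le (f := fun x => f x - f 0) (hint E hw) (ae_of_all _ hfw)).trans ?_
    refine integral_mono_measure ?_ (ae_of_all _ fun x => (hw x).1) (hint _ hw)
    exact Measure.map_mono (Measure.restrict_mono (Set.subset_univ E) le_rfl)
      (measurable_pi_apply t)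
  have hu := hreal (@MeasurableSet.univ _ (coordSigma (Set.Iic t)))
  rw [Set.univ_inter] at hu
  rw [hreal hA, hu, hcenter A, hcenter Set.univ, probReal_univ, one_mul]
  have d1 := hdev A
  have d2 := hdev Set.univ
  have hA0 : 0 ≤ μ.real A := measureReal_nonneg
  have hA1 : μ.real A ≤ 1 := measureReal_le_one
  rw [show ∀ a b c m : ℝ, a + m * c - m * (b + c) = a - m * b by intros; ring]
  refine (abs_sub _ _).trans ?_
  rw [abs_mul, abs_of_nonneg hA0]
  nlinarith [abs_nonneg (∫ x, (f x - f 0) ∂stateLaw μ Set.univ t)]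

theorem alphaMixing_nonneg (μ : Measure (ℕ → ℕ)) (k : ℕ) : 0 ≤ alphaMixing μ k :=
  Real.sSup_nonneg fun _ ⟨_, _, _, _, _, hr⟩ => hr ▸ abs_nonneg _

theorem IsChainLaw.alphaMixing_le {q : ℕ → ℝ} {μ : Measure (ℕ → ℕ)}
    (h : IsChainLaw q (bdHolding θ) μ) (hq : IsPMF q) (h0 : 0 < θ) (h1 : θ < 1) (hs : 1 ≤ s)
    (hlam : θ * s + (1 - θ) / s = lam) {k : ℕ} {D : ℝ} (hD0 : 0 ≤ D)
    (hD : ∀ t, ∫ x, mixingWeight s lam k x ∂stateLaw μ Set.univ t ≤ D) :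
    alphaMixing μ k ≤ 2 * D := by
  refine Real.sSup_le ?_ (by positivity)
  rintro _ ⟨t, A, B, hA, hB, rfl⟩
  have := h.abs_measure_inter_sub_le hq h0 h1 hs hlam hA hB
  linarith [hD t]

/-- The initial law need not integrate `s ^ x`, so the weight is kept truncated at one and no rate
is obtained. The drift bound moves the expectation at time `t` back to time `0`, uniformly in `t`,
and dominated convergence finishes. -/
theorem tendsto_alphaMixing_bdHolding {q : ℕ → ℝ} {μ : Measure (ℕ → ℕ)}
    (h : IsChainLaw q (bdHolding θ) μ) (hq : IsPMF q) (h0 : 0 < θ) (h1 : θ < 1) (hs : 1 ≤ s)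
    (hlam : θ * s + (1 - θ) / s = lam) (hl1 : lam < 1) :
    Tendsto (alphaMixing μ) atTop (nhds 0) := by
  have hp := isStochastic_bdHolding h0.le h1.le
  have := h.isProbabilityMeasure hq hp
  have hs0 : 0 < s := by linarith
  have h1' : 0 < 1 - θ := by linarith
  have hl : 0 < lam := by rw [← hlam]; positivity
  have hl1' : 0 < 1 - lam := by linarith
  have hprob : IsProbabilityMeasure (stateLaw μ Set.univ 0) :=
    ⟨by rw [stateLaw_univ, measure_univ]⟩
  set ψ : ℕ → ℕ → ℝ := fun k x => min 1 (lam ^ k * (s ^ x + 1 / (1 - lam))) with hψ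
  have hψ01 (k x : ℕ) : 0 ≤ ψ k x ∧ ψ k x ≤ 1 := ⟨le_min zero_le_one (by positivity), min_le_left _ _⟩
  have hψint (k : ℕ) : Integrable (ψ k) (stateLaw μ Set.univ 0) :=
    Integrable.of_bound (Measurable.of_discrete).aestronglyMeasurable 1
      (ae_of_all _ fun x => by rw [Real.norm_of_nonneg (hψ01 k x).1]; exact (hψ01 k x).2)
  have hle (k : ℕ) : alphaMixing μ k ≤ 2 * ∫ x, ψ k x ∂stateLaw μ Set.univ 0 := by
    refine h.alphaMixing_le hq h0 h1 hs hlam (integral_nonneg fun x => (hψ01 k x).1) fun t => ?_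
    have hw := mixingWeight_mem_Icc hs0.le hl.le k
    have hit := bdOp_iterate_mem_Icc h0.le h1.le hw t
    have e := h.lintegral_stateLaw_bdOp hq h0.le h1.le
      (@MeasurableSet.univ _ (coordSigma (Set.Iic 0))) t hw
    rw [zero_add] at e
    rw [integral_eq_lintegral_of_nonneg_ae (ae_of_all _ fun x => (hw x).1)
      (Measurable.of_discrete).aestronglyMeasurable, e,
      ← integral_eq_lintegral_of_nonneg_ae (ae_of_all _ fun x => (hit x).1)
      (Measurable.of_discrete).aestronglyMeasurable]
    refine integral_mono_of_nonneg (ae_of_all _ fun x => (hit x).1) (hψint k)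
      (ae_of_all _ fun x => le_min (hit x).2 ?_)
    exact bdOp_iterate_mixingWeight_le h0 h1 hs hlam hl1 k t x
  have hlim : Tendsto (fun k => ∫ x, ψ k x ∂stateLaw μ Set.univ 0) atTop
      (nhds (∫ _, (0 : ℝ) ∂stateLaw μ Set.univ 0)) := by
    refine tendsto_integral_of_dominated_convergence (fun _ => 1)
      (fun k => (hψint k).aestronglyMeasurable) (integrable_const _)
      (fun k => ae_of_all _ fun x => ?_) (ae_of_all _ fun x => ?_)
    · rw [Real.norm_of_nonneg (hψ01 k x).1]; exact (hψ01 k x).2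
    · have e : Tendsto (fun k : ℕ => lam ^ k * (s ^ x + 1 / (1 - lam))) atTop (nhds 0) := by
        simpa using (tendsto_pow_atTop_nhds_zero_of_lt_one hl.le hl1).mul_const
          (s ^ x + 1 / (1 - lam))
      exact squeeze_zero (fun k => (hψ01 k x).1) (fun k => min_le_right _ _) e
  rw [integral_zero] at hlim
  refine squeeze_zero (fun k => alphaMixing_nonneg μ k) hle ?_
  simpa using hlim.const_mul 2

theorem eq_geometric_of_isInvariantPMF_bdHolding {q : ℕ → ℝ} (h1 : θ < 1)
    (hq : IsInvariantPMF (bdHolding θ) q) (j : ℕ) : q j = q 0 * (θ / (1 - θ)) ^ j := by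
  have h1' : 1 - θ ≠ 0 := by linarith
  have hrec (j : ℕ) := (hasSum_mul_bdHolding θ q j).unique (hq.2 j)
  -- The net flux across each edge vanishes: it does at the barrier, and invariance carries this
  -- from one edge to the next.
  have hstep (j : ℕ) : q (j + 1) * (1 - θ) = θ * q j := by
    induction j with
    | zero =>
      have := hrec 0
      simp only [zero_add, Nat.zero_sub, if_true] at this
      linarith
    | succ j ih =>
      have := hrec (j + 1)
      rw [if_neg j.succ_ne_zero, Nat.add_sub_cancel] at this
      linarith
  induction j with
  | zero => simp
  | succ j ih =>
    have := hstep j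
    rw [ih] at this
    rw [eq_div_of_mul_eq h1' this, pow_succ]
    ring

/-- The invariant law is geometric with ratio the odds, so `θ / (1 - θ) * s < 1` makes `s ^ x`
integrable at every time. Then `α_k` is at most a multiple of `lam ^ k`, and any positive power of
it is summable. -/
theorem summable_alphaMixing_bdHolding {q : ℕ → ℝ} {μ : Measure (ℕ → ℕ)}
    (h : IsChainLaw q (bdHolding θ) μ) (hq : IsInvariantPMF (bdHolding θ) q) (h0 : 0 < θ)
    (h1 : θ < 1) (hs : 1 ≤ s) (hlam : θ * s + (1 - θ) / s = lam) (hl1 : lam < 1)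
    (hs' : θ / (1 - θ) * s < 1) {e : ℝ} (he : 0 < e) :
    Summable fun k => alphaMixing μ k ^ e := by
  have hp := isStochastic_bdHolding h0.le h1.le
  have := h.isProbabilityMeasure hq.1 hp
  have hs0 : 0 < s := by linarith
  have h1' : 0 < 1 - θ := by linarith
  have hl : 0 < lam := by rw [← hlam]; positivity
  set D := q 0 * (1 - θ / (1 - θ) * s)⁻¹ with hDdef
  have hqs : HasSum (fun x : ℕ => q x * s ^ x) D := by
    have hx (x : ℕ) : q x * s ^ x = q 0 * (θ / (1 - θ) * s) ^ x := by
      rw [eq_geometric_of_isInvariantPMF_bdHolding h1 hq x, mul_pow, mul_assoc]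
    simp only [hx]
    exact (hasSum_geometric_of_lt_one (by positivity) hs').mul_left (q 0)
  have hD0 : 0 ≤ D := hqs.nonneg fun x => mul_nonneg (hq.1.1 x) (by positivity)
  have hle (k : ℕ) : alphaMixing μ k ≤ 2 * (lam ^ k * D) := by
    refine h.alphaMixing_le hq.1 h0 h1 hs hlam (by positivity) fun t => ?_
    have hw := mixingWeight_mem_Icc hs0.le hl.le k
    rw [integral_eq_lintegral_of_nonneg_ae (ae_of_all _ fun x => (hw x).1)
      (Measurable.of_discrete).aestronglyMeasurable, lintegral_countable']
    refine ENNReal.toReal_le_of_le_ofReal (by positivity) ?_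
    have hsum := hqs.mul_left (lam ^ k)
    rw [← hsum.tsum_eq, ENNReal.ofReal_tsum_of_nonneg
      (fun x => mul_nonneg (by positivity) (mul_nonneg (hq.1.1 x) (by positivity))) hsum.summable]
    refine ENNReal.tsum_le_tsum fun x => ?_
    rw [h.stateLaw_singleton_of_invariant hq hp, ← ENNReal.ofReal_mul (hw x).1]
    refine ENNReal.ofReal_le_ofReal ?_
    have := mul_le_mul_of_nonneg_right (min_le_right 1 (lam ^ k * s ^ x)) (hq.1.1 x)
    unfold mixingWeight
    linarith
  refine Summable.of_nonneg_of_le (fun k => Real.rpow_nonneg (alphaMixing_nonneg μ k) e)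
    (fun k => Real.rpow_le_rpow (alphaMixing_nonneg μ k) (hle k) he.le) ?_
  have e1 : (fun k : ℕ => (2 * (lam ^ k * D)) ^ e) = fun k => (2 * D) ^ e * (lam ^ e) ^ k := by
    funext k
    rw [show 2 * (lam ^ k * D) = 2 * D * lam ^ k by ring,
      Real.mul_rpow (by positivity) (by positivity), ← Real.rpow_natCast, ← Real.rpow_natCast,
      ← Real.rpow_mul hl.le, ← Real.rpow_mul hl.le, mul_comm e]
  rw [e1]
  exact (summable_geometric_of_lt_one (by positivity)
    (Real.rpow_lt_one hl.le hl1 he)).mul_left _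

theorem mixingConditions_bdHolding (hθ : θ ∈ Set.Ioo (0 : ℝ) (1 / 2)) {q0 : ℕ → ℝ}
    (hq0 : IsPMF q0) {δ : ℝ} (hδ : 0 < δ) : MixingConditions (bdHolding θ) q0 δ := by
  obtain ⟨h0, h1⟩ := hθ
  have h1' : 0 < 1 - θ := by linarith
  -- Both `lam < 1` and integrability of `s ^ x` hold exactly for `s` between `1` and `(1 - θ) / θ`
  -- (among `s > 1`); the choice `s = 1 / (2 * θ)` is the midpoint.
  have hs : 1 ≤ 1 / (2 * θ) := by
    rw [le_div_iff₀ (by positivity)]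
    linarith
  have hlam : θ * (1 / (2 * θ)) + (1 - θ) / (1 / (2 * θ)) = 1 / 2 + 2 * θ * (1 - θ) := by
    field_simp
  have hl1 : 1 / 2 + 2 * θ * (1 - θ) < 1 := by nlinarith
  refine ⟨fun μ h => tendsto_alphaMixing_bdHolding h hq0 h0 (by linarith) hs hlam hl1,
    fun q hq μ h => summable_alphaMixing_bdHolding h hq h0 (by linarith) hs hlam hl1 ?_
      (by positivity)⟩
  have : θ / (1 - θ) * (1 / (2 * θ)) = 1 / (2 * (1 - θ)) := by field_simp
  rw [this, div_lt_one (by positivity)]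
  linarith

end

theorem mainTheorem10 (θ0 : ℝ) (hθ0 : θ0 ∈ Set.Ioo (0 : ℝ) (1 / 2))
    (a b : ℝ) (ha : 0 < a) (hb : 0 < b)
    (q0 : ℕ → ℝ) (hq0 : IsPMF q0) (hmom : Summable (fun i : ℕ => (i : ℝ) ^ 2 * q0 i)) :
    (∃ (δ : ℝ) (ρ : ℕ → Measure ℝ) (ε : ℕ → ℝ),
      0 < δ ∧ δ ≤ 1 ∧ (∀ n, 1 ≤ n → ρ n ∈ scaledBetaFamily) ∧
      RegularityConditions (Set.Ioo 0 (1 / 2)) (scaledBeta a b) bdHolding q0 θ0 δ ρ ∧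
      MixingConditions (bdHolding θ0) q0 δ ∧
      (∀ n, 1 ≤ n → 0 < ε n) ∧ ε =O[atTop] (fun n : ℕ => 1 / √(n : ℝ)) ∧
      PACBayesConditions (Set.Ioo 0 (1 / 2)) (scaledBeta a b) bdHolding q0 θ0 ρ ε) ∧
    (∃ (δ : ℝ) (ρ : ℕ → Measure ℝ) (ε : ℕ → ℝ),
      0 < δ ∧ δ ≤ 1 ∧ (∀ n, 1 ≤ n → ρ n ∈ scaledBetaFamily) ∧
      RegularityConditions (Set.Ioo 0 (1 / 2)) (scaledBeta a b) bdReflecting q0 θ0 δ ρ ∧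
      (∀ n, 1 ≤ n → 0 < ε n) ∧ ε =O[atTop] (fun n : ℕ => 1 / √(n : ℝ)) ∧
      PACBayesConditions (Set.Ioo 0 (1 / 2)) (scaledBeta a b) bdReflecting q0 θ0 ρ ε) := by
  refine ⟨?_, ?_⟩
  · obtain ⟨ρ, ε, hρ, hA, hε0, hε, hC⟩ := exists_regularity_and_PACBayes
      isLogLipschitzFamily_bdHolding (fun _ => isInvariantPMF_holdingInvariant)
      (fun _ h1 _ h2 => abs_log_holdingInvariant_sub_le h1 h2) hθ0 ha hb hq0 hmom
    exact ⟨1, ρ, ε, one_pos, le_rfl, hρ, hA, mixingConditions_bdHolding hθ0 hq0 one_pos, hε0, hε,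
      hC⟩
  · obtain ⟨ρ, ε, hρ, hA, hε0, hε, hC⟩ := exists_regularity_and_PACBayes
      isLogLipschitzFamily_bdReflecting (fun _ => isInvariantPMF_reflectingInvariant)
      (fun _ h1 _ h2 => abs_log_reflectingInvariant_sub_le h1 h2) hθ0 ha hb hq0 hmom
    exact ⟨1, ρ, ε, one_pos, le_rfl, hρ, hA, hε0, hε, hC⟩
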